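/- Let $\mathfrak k$ be a finite-dimensional simple complex Lie algebra and let $K$ be the simply connected complex linear algebraic group with Lie algebra $\mathfrak k$. Let $\mathfrak s\subseteq\mathfrak k$ be a simple Lie subalgebra and let $S\subseteq K$ be the connected Zariski closed subgroup with Lie algebra $\mathfrak s$. Fix (independently) a Cartan subalgebra and a system of simple roots for each of $\mathfrak k$ and $\mathfrak s$, and let $P_+(\mathfrak k)$, $P_+(\mathfrak s)$ be the corresponding sets of dominant integral weights. For $\lambda\in P_+(\mathfrak k)$ (resp. $\mu\in P_+(\mathfrak s)$) let $L_K(\lambda)$ (resp. $L_S(\mu)$) denote the irreducible rational representation of $K$ (resp. of $S$, if it exists) with highest weight $\lambda$ (resp. $\mu$). For a rational representation $V$ of $S$ we say that $L_S(\mu)$ occurs in $V$ if $L_S(\mu)$ exists and $\dim\operatorname{Hom}_S(L_S(\mu),V)>0$. Representations of $K$ are restricted to $S$ where needed. (1) Let $\lambda_1,\lambda_2\in P_+(\mathfrak k)$ and $\mu_1,\mu_2\in P_+(\mathfrak s)$. If $L_S(\mu_j)$ occurs in $L_K(\lambda_j)$ for $j=1$ and $j=2$, then $L_S(\mu_1+\mu_2)$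 occurs in $L_K(\lambda_1+\lambda_2)$. (2) Let $\lambda_1,\lambda_2\in P_+(\mathfrak k)$ and $\mu\in P_+(\mathfrak s)$, and suppose that $L_K(\lambda_2)^S\neq(0)$. If $L_S(\mu)$ occurs in $L_K(\lambda_1)$, then $L_S(\mu)$ occurs in $L_K(\lambda_1+k\lambda_2)$ for every integer $k\ge 0$. -/

import Mathlib

attribute [local instance 100] LieRing.ofAssociativeRing

noncomputable section

namespace Branching

open Module LieAlgebra

/-! ### Complex linear algebraic groups and their Lie algebras -/

/-- A subgroup of `GL(n, ℂ)` is Zariski closed if it is the set of common zeros in `GL(n, ℂ)` of a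
family of polynomials in the matrix entries. -/
def IsZariskiClosed {n : ℕ} (G : Subgroup (GL (Fin n) ℂ)) : Prop :=
  ∃ I : Set (MvPolynomial (Fin n × Fin n) ℂ), ∀ g : GL (Fin n) ℂ,
    g ∈ G ↔ ∀ p ∈ I, MvPolynomial.eval (fun ij => g.val ij.1 ij.2) p = 0

/-- `𝔤` is the Lie algebra of the Zariski closed subgroup `G` of `GL(n, ℂ)`: it consists of the
matrices `X` such that `exp (t X)` lies in `G` for all complex `t`. -/
def IsLieAlgebraOf {n : ℕ} (𝔤 : LieSubalgebra ℂ (Matrix (Fin n) (Fin n) ℂ))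
    (G : Subgroup (GL (Fin n) ℂ)) : Prop :=
  ∀ X : Matrix (Fin n) (Fin n) ℂ,
    X ∈ 𝔤 ↔ ∀ t : ℂ, ∃ g ∈ G, g.val = NormedSpace.exp (t • X)

/-- Regular functions on `G`: restrictions to `G` of polynomials in the matrix entries and the
inverse of the determinant. -/
def IsRegular {n : ℕ} (G : Subgroup (GL (Fin n) ℂ)) (f : G → ℂ) : Prop :=
  ∃ p : MvPolynomial (Option (Fin n × Fin n)) ℂ, ∀ g : G,
    f g = MvPolynomial.eval
      (fun o => o.elim (g.val.val.det)⁻¹ (fun ij => g.val.val ij.1 ij.2)) p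

/-- A finite-dimensional representation is rational if its matrix coefficients are regular. -/
def IsRational {n : ℕ} {G : Subgroup (GL (Fin n) ℂ)} {V : Type*} [AddCommGroup V] [Module ℂ V]
    (ρ : Representation ℂ G V) : Prop :=
  ∀ (φ : Dual ℂ V) (v : V), IsRegular G (fun g => φ (ρ g v))

/-! ### Weights -/

section Weights

variable {n : ℕ} {𝔤 : LieSubalgebra ℂ (Matrix (Fin n) (Fin n) ℂ)} [LieAlgebra.IsSimple ℂ 𝔤]
  {H : LieSubalgebra ℂ 𝔤} [H.IsCartanSubalgebra]

/-- The dominant integral weights with respect to the base `b` of simple roots: the weights that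
take values in `ℕ` on the simple coroots, that is, the `ℕ`-combinations of the fundamental
weights. -/
def dominantWeights (b : (IsKilling.rootSystem H).Base) : Set (Dual ℂ H) :=
  {l | ∀ i ∈ b.support, ∃ m : ℕ, l ((IsKilling.rootSystem H).coroot i) = m}

/-- The sum `𝔫⁺` of the positive root spaces with respect to the base `b`. -/
def nilradical (b : (IsKilling.rootSystem H).Base) : Submodule ℂ 𝔤 :=
  ⨆ i ∈ {i : H.root | (IsKilling.rootSystem H).root i ∈
      AddSubmonoid.closure ((IsKilling.rootSystem H).root '' b.support)},
    (rootSpace H (i : H.root).val).toSubmodule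

variable {G : Subgroup (GL (Fin n) ℂ)} {V : Type*} [AddCommGroup V] [Module ℂ V]

/-- `v` is a highest weight vector of weight `l`: it is nonzero, the maximal torus `exp H` acts on
it by the character `exp h ↦ e ^ (l h)`, and the maximal unipotent subgroup `exp 𝔫⁺` fixes it. -/
def IsHighestWeightVector (b : (IsKilling.rootSystem H).Base) (ρ : Representation ℂ G V)
    (l : Dual ℂ H) (v : V) : Prop :=
  v ≠ 0 ∧
  (∀ (h : H) (g : G), g.val.val = NormedSpace.exp (h : 𝔤).val → ρ g v = Complex.exp (l h) • v) ∧
  (∀ X ∈ nilradical b, ∀ g : G, g.val.val = NormedSpace.exp (X : 𝔤).val → ρ g v = v)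

/-- `ρ` is (a model of) the irreducible rational representation `L_G(l)` of `G` with highest
weight `l`. -/
structure IsHighestWeightRep (b : (IsKilling.rootSystem H).Base) (ρ : Representation ℂ G V)
    (l : Dual ℂ H) : Prop where
  finite : FiniteDimensional ℂ V
  rational : IsRational ρ
  irreducible : ρ.IsIrreducible
  exists_vector : ∃ v, IsHighestWeightVector b ρ l v

/-- The multiplicity `mult_G(σ : ρ) = dim Hom_G(σ, ρ)`. -/
def mult {G : Type*} [Monoid G] {W V : Type*} [AddCommGroup W] [Module ℂ W]
    [AddCommGroup V] [Module ℂ V] (σ : Representation ℂ G W) (ρ : Representation ℂ G V) : ℕ :=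
  finrank ℂ (Representation.IntertwiningMap σ ρ)

/-- `L_G(l)` occurs in `ρ`: the irreducible rational representation `L_G(l)` of `G` exists and
`mult_G(L_G(l) : ρ) > 0`. -/
def Occurs (b : (IsKilling.rootSystem H).Base) (l : Dual ℂ H) (ρ : Representation ℂ G V) : Prop :=
  ∃ (W : Type) (_ : AddCommGroup W) (_ : Module ℂ W) (σ : Representation ℂ G W),
    IsHighestWeightRep b σ l ∧ 0 < mult σ ρ

end Weights

/-- The restriction of a representation of `K` to the subgroup `S`. -/
def res {n : ℕ} {S K : Subgroup (GL (Fin n) ℂ)} (hSK : S ≤ K) {V : Type*} [AddCommGroup V]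
    [Module ℂ V] (ρ : Representation ℂ K V) : Representation ℂ S V :=
  ρ.comp (Subgroup.inclusion hSK)

end Branching

end

/-! The argument turns branching into multiplication of functions. Let `ξ` be a lowest weight
covector of `L_K(λ)`, that is, a functional of weight `λ` killing the image of `𝔫⁻`. Sending `w` to
`g ↦ ξ (g w)` embeds `L_K(λ)` in the regular functions on `K`, equivariantly for right translation.
The image consists of left semi-invariants of weight `λ` for the opposite Borel subgroup
(`IsHighestWeightRep.exists_embedding`). A highest weight vector for `S` of weight `μ` in `L_K(λ)`
thus becomes a nonzero regular function with left weight `λ` and right weight `μ`: an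
`IsBranchingFunction`.

Conversely, such a function yields an occurrence of `L_S(μ)` in `L_K(λ)`. It lies in a
finite-dimensional translation-stable space of semi-invariants, and by Weyl's theorem it has a
nonzero projection to some irreducible submodule. Evaluation at the identity is a lowest weight
covector of weight `λ` there, so this submodule embeds in `L_K(λ)`
(`IsHighestWeightRep.exists_equivariant`). The image of the function is a highest weight vector for
`S`, and complete reducibility over `S` turns it into an occurrence
(`occurs_of_isHighestWeightVector`).

Both weights add under multiplication, and the product of two nonzero regular functions is nonzero
because `K` is connected (`IsRegular.mul_ne_zero`). This gives (1). For (2), an `S`-invariant vector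
is a highest weight vector of weight zero, so multiplying repeatedly by its function adds `λ₂` on
the left and leaves `μ` unchanged.

The passage between groups and Lie algebras rests on differentiating rational representations and on
`closure_range_expElt`: a connected Zariski closed group is generated by exponentials. -/

namespace Branching

open Module

/-! ### Trace forms and Casimir operators of irreducible modules -/

section CompleteReducibility

variable {𝕜 L : Type*} [Field 𝕜] [LieRing L] [LieAlgebra 𝕜 L] [LieAlgebra.IsSimple 𝕜 L]

/-- A simple Lie algebra is perfect. -/
lemma derivedSeries_one_eq_top : LieAlgebra.derivedSeries 𝕜 L 1 = ⊤ := by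
  rcases LieAlgebra.IsSimple.eq_bot_or_eq_top (R := 𝕜) (LieAlgebra.derivedSeries 𝕜 L 1) with h | h
  · exfalso
    refine LieAlgebra.IsSimple.non_abelian (R := 𝕜) (L := L) ⟨fun x y => ?_⟩
    have := ((LieAlgebra.abelian_iff_derived_one_eq_bot (R := 𝕜) (L := L) ⊤).mpr h).trivial
      (⟨x, trivial⟩ : (⊤ : LieIdeal 𝕜 L)) ⟨y, trivial⟩
    simpa using congrArg Subtype.val this
  · exact h

variable (𝕜) in
lemma mem_span_lie (x : L) : x ∈ Submodule.span 𝕜 {⁅u, v⁆ | (u : L) (v : L)} := by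
  rw [← LieAlgebra.coe_derivedSeries_one_eq, derivedSeries_one_eq_top]
  trivial

variable {V : Type*} [AddCommGroup V] [Module 𝕜 V] [LieRingModule L V] [LieModule 𝕜 L V]

lemma lieDerivation_eq_zero_of_isTrivial [LieModule.IsTrivial L V] (d : LieDerivation 𝕜 L V)
    (x : L) : d x = 0 := by
  induction mem_span_lie 𝕜 x using Submodule.span_induction with
  | mem u hu => obtain ⟨a, b, rfl⟩ := hu; rw [d.apply_lie_eq_sub, trivial_lie_zero, trivial_lie_zero, sub_zero]
  | zero => simp
  | add u v _ _ hu hv => simp [hu, hv]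
  | smul t u _ hu => simp [hu]

/-- By invariance the radical of the form is an ideal, and simplicity leaves only zero once the form
is nonzero. -/
lemma traceForm_nondegenerate (h : LieModule.traceForm 𝕜 L V ≠ 0) :
    (LieModule.traceForm 𝕜 L V).Nondegenerate := by
  let I : LieIdeal 𝕜 L :=
    { LinearMap.ker (LieModule.traceForm 𝕜 L V) with
      lie_mem := by
        intro x m hm
        have hm : LieModule.traceForm 𝕜 L V m = 0 := hm
        change LieModule.traceForm 𝕜 L V ⁅x, m⁆ = 0
        ext y
        rw [← lie_skew, map_neg, LinearMap.neg_apply, LieModule.traceForm_apply_lie_apply, hm]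
        simp }
  have hI : I = ⊥ := by
    refine (LieAlgebra.IsSimple.eq_bot_or_eq_top I).resolve_right fun hI => h ?_
    ext x y
    have : x ∈ I := by rw [hI]; trivial
    have : LieModule.traceForm 𝕜 L V x = 0 := this
    simp [this]
  have hsep (x : L) (hx : ∀ y, LieModule.traceForm 𝕜 L V x y = 0) : x = 0 := by
    have : x ∈ I := LinearMap.mem_ker.mpr (LinearMap.ext hx)
    simpa [hI] using this
  exact ⟨hsep, fun x hx => hsep x fun y => by rw [LieModule.traceForm_comm, hx]⟩

variable [FiniteDimensional 𝕜 V]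

/-- Cartan's criterion: if the trace form vanished, the derived algebra, which is all of `L`, would
act nilpotently. There would then be nonzero invariant vectors, and irreducibility would make the
module trivial. -/
lemma traceForm_ne_zero [CharZero 𝕜] [LieModule.IsIrreducible 𝕜 L V]
    (h : ¬ LieModule.IsTrivial L V) : LieModule.traceForm 𝕜 L V ≠ 0 := by
  intro h0
  have h1 := LieModule.isNilpotent_derivedSeries_of_traceForm_eq_zero h0
  rw [LieModule.isNilpotent_iff_forall' (R := 𝕜), derivedSeries_one_eq_top] at h1
  have h2 : LieModule.IsNilpotent L V := by
    rw [LieModule.isNilpotent_iff_forall' (R := 𝕜)]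
    exact fun x => h1 ⟨x, trivial⟩
  have : Nontrivial V := LieModule.nontrivial_of_isIrreducible 𝕜 L V
  have h3 := LieModule.nontrivial_max_triv_of_isNilpotent 𝕜 L V
  have h4 := LieSubmodule.eq_top_of_isIrreducible 𝕜 L V (LieModule.maxTrivSubmodule 𝕜 L V)
  exact h ((LieModule.isTrivial_iff_max_triv_eq_top 𝕜 L V).mpr h4)

section Casimir

variable [FiniteDimensional 𝕜 L] {B : LinearMap.BilinForm 𝕜 L} (hB : B.Nondegenerate)
  (hsymm : B.IsSymm) (hinv : ∀ x y z, B ⁅x, y⁆ z = B x ⁅y, z⁆)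

/-- The basis of a Lie algebra dual to a fixed one with respect to a nondegenerate form. -/
noncomputable abbrev formDualBasis : Basis (Fin (finrank 𝕜 L)) 𝕜 L :=
  B.dualBasis hB (finBasis 𝕜 L)

-- Invariance of the tensor `∑ bᵢ ⊗ bⁱ`, tested on an arbitrary bilinear map `β`: for an invariant
-- form, `ad x` has opposite transposed matrices in the two dual bases.
omit [LieAlgebra.IsSimple 𝕜 L] in
include hsymm hinv in
lemma sum_lie_dualBasis {M : Type*} [AddCommGroup M] [Module 𝕜 M] (β : L →ₗ[𝕜] L →ₗ[𝕜] M) (x : L) :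
    ∑ i, β ⁅x, finBasis 𝕜 L i⁆ (formDualBasis hB i) +
      ∑ i, β (finBasis 𝕜 L i) ⁅x, formDualBasis hB i⁆ = 0 := by
  set b := finBasis 𝕜 L
  have h1 (y : L) : y = ∑ j, B y (formDualBasis hB j) • b j := by
    conv_lhs => rw [← (B.dualBasis hB (formDualBasis hB)).sum_repr y]
    simp_rw [LinearMap.BilinForm.dualBasis_repr_apply,
      LinearMap.BilinForm.dualBasis_dualBasis hB hsymm]
    rfl
  have h2 (y : L) : y = ∑ j, B y (b j) • formDualBasis hB j := by
    conv_lhs => rw [← (formDualBasis hB).sum_repr y]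
    simp_rw [LinearMap.BilinForm.dualBasis_repr_apply]
    rfl
  have h3 (i : Fin (finrank 𝕜 L)) : β ⁅x, b i⁆ (formDualBasis hB i) =
      ∑ j, B ⁅x, b i⁆ (formDualBasis hB j) • β (b j) (formDualBasis hB i) := by
    conv_lhs => rw [h1 ⁅x, b i⁆]
    simp
  have h4 (j : Fin (finrank 𝕜 L)) : β (b j) ⁅x, formDualBasis hB j⁆ =
      ∑ i, B ⁅x, formDualBasis hB j⁆ (b i) • β (b j) (formDualBasis hB i) := by
    conv_lhs => rw [h2 ⁅x, formDualBasis hB j⁆]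
    simp
  simp_rw [h3, h4]
  rw [Finset.sum_comm, ← Finset.sum_add_distrib]
  refine Finset.sum_eq_zero fun j _ => ?_
  rw [← Finset.sum_add_distrib]
  refine Finset.sum_eq_zero fun i _ => ?_
  rw [← add_smul, ← lie_skew x (b i), map_neg, LinearMap.neg_apply, hinv,
    hsymm.eq, neg_add_cancel, zero_smul]

variable (V) in
/-- The Casimir operator of a nondegenerate form. -/
noncomputable def casimir : Module.End 𝕜 V :=
  ∑ i, LieModule.toEnd 𝕜 L V (finBasis 𝕜 L i) ∘ₗ LieModule.toEnd 𝕜 L V (formDualBasis hB i)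

omit [LieAlgebra.IsSimple 𝕜 L] [FiniteDimensional 𝕜 V] in
lemma casimir_apply (v : V) :
    casimir V hB v = ∑ i, ⁅finBasis 𝕜 L i, ⁅formDualBasis hB i, v⁆⁆ := by
  simp [casimir]

omit [LieAlgebra.IsSimple 𝕜 L] [FiniteDimensional 𝕜 V] in
include hsymm hinv in
/-- The key identity: `x • ∑ bᵢ • d(bⁱ) = C (d x)` for a derivation `d` and the Casimir `C`. -/
lemma lie_sum_derivation (d : LieDerivation 𝕜 L V) (x : L) :
    ⁅x, ∑ i, ⁅finBasis 𝕜 L i, d (formDualBasis hB i)⁆⁆ = casimir V hB (d x) := by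
  let β : L →ₗ[𝕜] L →ₗ[𝕜] V :=
    (LieModule.toEnd 𝕜 L V : L →ₗ[𝕜] Module.End 𝕜 V).compl₂ d.toLinearMap
  have hβ (y z : L) : β y z = ⁅y, d z⁆ := rfl
  have h := sum_lie_dualBasis hB hsymm hinv β x
  simp only [hβ] at h
  rw [casimir_apply, lie_sum, ← sub_eq_zero, ← h, ← Finset.sum_sub_distrib,
    ← Finset.sum_add_distrib]
  refine Finset.sum_congr rfl fun i _ => ?_
  rw [d.apply_lie_eq_sub, lie_lie, lie_sub]
  abel

omit [LieAlgebra.IsSimple 𝕜 L] [FiniteDimensional 𝕜 V] in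
include hsymm hinv in
lemma lie_casimir (x : L) (v : V) : ⁅x, casimir V hB v⁆ = casimir V hB ⁅x, v⁆ := by
  let β : L →ₗ[𝕜] L →ₗ[𝕜] V :=
    (LieModule.toEnd 𝕜 L V : L →ₗ[𝕜] Module.End 𝕜 V).compl₂
      ((LieModule.toEnd 𝕜 L V : L →ₗ[𝕜] Module.End 𝕜 V).flip v)
  have hβ (y z : L) : β y z = ⁅y, ⁅z, v⁆⁆ := rfl
  have h := sum_lie_dualBasis hB hsymm hinv β x
  simp only [hβ] at h
  rw [casimir_apply, casimir_apply, lie_sum, ← sub_eq_zero, ← h, ← Finset.sum_sub_distrib,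
    ← Finset.sum_add_distrib]
  refine Finset.sum_congr rfl fun i _ => ?_
  simp only [lie_lie, lie_sub]
  abel

end Casimir

variable [FiniteDimensional 𝕜 L] [CharZero 𝕜]

/-- The Casimir operator of the trace form of a nontrivial irreducible module is bijective. -/
lemma casimir_bijective [LieModule.IsIrreducible 𝕜 L V]
    (hB : (LieModule.traceForm 𝕜 L V).Nondegenerate) : Function.Bijective (casimir V hB) := by
  have hsymm : LinearMap.BilinForm.IsSymm (LieModule.traceForm 𝕜 L V) :=
    ⟨LieModule.traceForm_comm 𝕜 L V⟩
  have hinv := LieModule.traceForm_apply_lie_apply 𝕜 L V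
  let N : LieSubmodule 𝕜 L V :=
    { LinearMap.ker (casimir V hB) with
      lie_mem := by
        intro x m hm
        have hm : casimir V hB m = 0 := hm
        change casimir V hB ⁅x, m⁆ = 0
        rw [← lie_casimir hB hsymm hinv, hm, lie_zero] }
  -- Each summand has trace `B(bᵢ, bⁱ) = 1`. The trace is therefore `dim L`, which is nonzero in
  -- characteristic zero, so the Casimir operator cannot vanish.
  have htr : LinearMap.trace 𝕜 V (casimir V hB) = finrank 𝕜 L := by
    have (i : Fin (finrank 𝕜 L)) := LinearMap.BilinForm.apply_dualBasis_right hB hsymm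
      (finBasis 𝕜 L) i i
    simp only [if_true, LieModule.traceForm_apply_apply] at this
    simp [casimir, this]
  have : Nontrivial L := by
    by_contra hL
    rw [not_nontrivial_iff_subsingleton] at hL
    exact LieAlgebra.IsSimple.non_abelian (R := 𝕜) (L := L) ⟨fun x y => Subsingleton.elim _ _⟩
  have hN : N = ⊥ := by
    refine (eq_bot_or_eq_top N).resolve_right fun hN => ?_
    have : casimir V hB = 0 := by
      ext v
      have : v ∈ N := by rw [hN]; trivial
      exact this
    rw [this, map_zero] at htr
    exact (finrank_pos (R := 𝕜) (M := L)).ne (by exact_mod_cast htr)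
  have hinj : Function.Injective (casimir V hB) := by
    rw [← LinearMap.ker_eq_bot, eq_bot_iff]
    intro v hv
    have : v ∈ N := hv
    simpa [hN] using this
  exact ⟨hinj, LinearMap.injective_iff_surjective.mp hinj⟩

/-- With `C` the Casimir operator, choose `w` with `C w = ∑ bᵢ • d(bⁱ)`. Then `C (d x) = x • C w = C
(x • w)`, and `C` can be cancelled. -/
lemma exists_derivation_eq_of_irreducible [LieModule.IsIrreducible 𝕜 L V]
    (d : LieDerivation 𝕜 L V) : ∃ w : V, ∀ x, d x = ⁅x, w⁆ := by
  by_cases h : LieModule.IsTrivial L V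
  · exact ⟨0, fun x => by rw [lieDerivation_eq_zero_of_isTrivial, lie_zero]⟩
  have hB := traceForm_nondegenerate (𝕜 := 𝕜) (L := L) (V := V) (traceForm_ne_zero h)
  have hsymm : LinearMap.BilinForm.IsSymm (LieModule.traceForm 𝕜 L V) :=
    ⟨LieModule.traceForm_comm 𝕜 L V⟩
  have hinv := LieModule.traceForm_apply_lie_apply 𝕜 L V
  obtain ⟨w, hw⟩ := (casimir_bijective hB).2 (∑ i, ⁅finBasis 𝕜 L i, d (formDualBasis hB i)⁆)
  refine ⟨w, fun x => (casimir_bijective hB).1 ?_⟩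
  rw [← lie_sum_derivation hB hsymm hinv, ← hw, lie_casimir hB hsymm hinv]

end CompleteReducibility
end Branching

namespace Branching

open Module

/-! ### Whitehead's first lemma and Weyl's theorem -/

section CompleteReducibility

universe u
variable {𝕜 L : Type*} [Field 𝕜] [CharZero 𝕜] [LieRing L] [LieAlgebra 𝕜 L]
  [LieAlgebra.IsSimple 𝕜 L] [FiniteDimensional 𝕜 L]

/-- Whitehead's first lemma: derivations of a simple Lie algebra with values in a
finite-dimensional module are inner. -/
theorem exists_derivation_eq {V : Type u} [AddCommGroup V] [Module 𝕜 V] [LieRingModule L V]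
    [LieModule 𝕜 L V] [FiniteDimensional 𝕜 V] (d : LieDerivation 𝕜 L V) :
    ∃ w : V, ∀ x, d x = ⁅x, w⁆ := by
  induction hn : finrank 𝕜 V using Nat.strong_induction_on generalizing V with
  | _ n ih =>
  subst hn
  by_cases hV : Subsingleton V
  · exact ⟨0, fun x => Subsingleton.elim _ _⟩
  rw [not_subsingleton_iff_nontrivial] at hV
  by_cases hirr : ∀ N : LieSubmodule 𝕜 L V, N ≠ ⊥ → N = ⊤
  · have := LieModule.IsIrreducible.mk hirr
    exact exists_derivation_eq_of_irreducible d
  push Not at hirr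
  obtain ⟨N, hN, hN'⟩ := hirr
  have hpos : 0 < finrank 𝕜 N := by
    have := (LieSubmodule.nontrivial_iff_ne_bot 𝕜 L V).mpr hN
    exact finrank_pos
  have hlt : finrank 𝕜 N < finrank 𝕜 V := by
    apply Submodule.finrank_lt (s := N.toSubmodule)
    rwa [Ne, LieSubmodule.toSubmodule_eq_top]
  have hq : finrank 𝕜 (V ⧸ N) < finrank 𝕜 V := by
    have : finrank 𝕜 (V ⧸ N) + finrank 𝕜 N = finrank 𝕜 V :=
      Submodule.finrank_quotient_add_finrank N.toSubmodule
    lia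
  let π := LieSubmodule.Quotient.mk' N
  let d₁ : LieDerivation 𝕜 L (V ⧸ N) :=
    { toLinearMap := (π : V →ₗ[𝕜] V ⧸ N) ∘ₗ d.toLinearMap
      leibniz' := fun a b => by
        change π (d ⁅a, b⁆) = ⁅a, π (d b)⁆ - ⁅b, π (d a)⁆
        rw [d.apply_lie_eq_sub, map_sub, LieModuleHom.map_lie, LieModuleHom.map_lie] }
  have : FiniteDimensional 𝕜 (V ⧸ N) :=
    inferInstanceAs (FiniteDimensional 𝕜 (V ⧸ N.toSubmodule))
  obtain ⟨w₁, hw₁⟩ := ih _ hq d₁ rfl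
  obtain ⟨u, rfl⟩ := LieSubmodule.Quotient.surjective_mk' N w₁
  have hmem (x : L) : d x - ⁅x, u⁆ ∈ N := by
    rw [← LieSubmodule.Quotient.mk_eq_zero', ← LieSubmodule.Quotient.mk'_apply, map_sub,
      LieModuleHom.map_lie, sub_eq_zero]
    exact hw₁ x
  -- Subtracting the inner derivation of a lift of the solution modulo `N` leaves a derivation with
  -- values in `N`, to which induction applies.
  let d₂ : LieDerivation 𝕜 L N :=
    { toLinearMap := (d - LieDerivation.inner 𝕜 L V u).toLinearMap.codRestrict N.toSubmodule hmem
      leibniz' := fun a b => Subtype.ext ((d - LieDerivation.inner 𝕜 L V u).apply_lie_eq_sub a b) }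
  obtain ⟨w₂, hw₂⟩ := ih _ hlt d₂ rfl
  refine ⟨u + w₂, fun x => ?_⟩
  have : d x - ⁅x, u⁆ = ⁅x, w₂.1⁆ := congrArg Subtype.val (hw₂ x)
  rw [lie_add, ← this, add_sub_cancel]

/-- **Weyl's theorem**: submodules of finite-dimensional modules over a simple Lie algebra are
equivariant retracts. -/
theorem exists_lieModuleHom_retract {V : Type u} [AddCommGroup V] [Module 𝕜 V] [LieRingModule L V]
    [LieModule 𝕜 L V] [FiniteDimensional 𝕜 V] (N : LieSubmodule 𝕜 L V) :
    ∃ q : V →ₗ⁅𝕜, L⁆ N, ∀ n : N, q n = n := by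
  obtain ⟨p, hp⟩ : ∃ p : V →ₗ[𝕜] N, p ∘ₗ N.toSubmodule.subtype = LinearMap.id := N.toSubmodule.subtype.exists_leftInverse_of_injective
    (LinearMap.ker_eq_bot.mpr N.toSubmodule.injective_subtype)
  have hp (n : N) : p n = n := LinearMap.congr_fun hp n
  -- Since a linear retraction `p` is the identity on `N`, the map `x ↦ ⁅x, p⁆` is a derivation with
  -- values in the maps vanishing on `N`. Writing it as `⁅x, w⁆` makes `p - w` equivariant without
  -- changing it on `N`.
  let E : LieSubmodule 𝕜 L (V →ₗ[𝕜] N) :=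
    { carrier := {f | ∀ n ∈ N, f n = 0}
      add_mem' := fun hf hg n hn => by simp [hf n hn, hg n hn]
      zero_mem' := fun n hn => rfl
      smul_mem' := fun c f hf n hn => by simp [hf n hn]
      lie_mem := fun {x f} hf n hn => by
        rw [LieHom.lie_apply, hf n hn, hf _ (N.lie_mem hn), lie_zero, sub_zero] }
  have hmem (x : L) : ⁅x, p⁆ ∈ E := fun n hn => by
    rw [LieHom.lie_apply, hp ⟨n, hn⟩]
    have := hp ⟨_, N.lie_mem (x := x) hn⟩
    simp only at this
    rw [this, sub_eq_zero]
    rfl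
  let d : LieDerivation 𝕜 L E :=
    { toLinearMap := LinearMap.codRestrict E.toSubmodule
        ((LieModule.toEnd 𝕜 L (V →ₗ[𝕜] N) : L →ₗ[𝕜] Module.End 𝕜 (V →ₗ[𝕜] N)).flip p) hmem
      leibniz' := fun a b => Subtype.ext (lie_lie a b p) }
  obtain ⟨w, hw⟩ := exists_derivation_eq d
  have hw (x : L) : ⁅x, p⁆ = ⁅x, w.1⁆ := congrArg Subtype.val (hw x)
  let q : V →ₗ⁅𝕜, L⁆ N :=
    { p - w.1 with
      map_lie' := fun {x v} => by
        have := LinearMap.congr_fun (hw x) v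
        rw [LieHom.lie_apply, LieHom.lie_apply] at this
        change p ⁅x, v⁆ - w.1 ⁅x, v⁆ = ⁅x, p v - w.1 v⁆
        rw [lie_sub, sub_eq_sub_iff_sub_eq_sub, ← neg_sub, this, neg_sub] }
  refine ⟨q, fun n => ?_⟩
  change p n - w.1 n = n
  rw [hp, w.2 n n.2, sub_zero]

/-- A vector on which a functional does not vanish can be projected equivariantly to an irreducible
submodule so that the functional does not vanish on the image. -/
theorem exists_irreducible_projection {V : Type u} [AddCommGroup V] [Module 𝕜 V]
    [LieRingModule L V] [LieModule 𝕜 L V] [FiniteDimensional 𝕜 V] (φ : Dual 𝕜 V) (u : V)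
    (hu : φ u ≠ 0) :
    ∃ (A : LieSubmodule 𝕜 L V) (p : V →ₗ⁅𝕜, L⁆ V), (∀ N ≤ A, N ≠ ⊥ → N = A) ∧
      (∀ x, p x ∈ A) ∧ φ (p u) ≠ 0 := by
  -- Take `A` minimal. A nonzero proper `N` in `A` has a retraction `q'`, which splits `p u` into
  -- parts in `N` and in `A ⊓ ker q'`. Both submodules are smaller than `A`, so `φ` would kill both
  -- parts.
  let S : Set (LieSubmodule 𝕜 L V) :=
    {A | ∃ p : V →ₗ⁅𝕜, L⁆ V, (∀ x, p x ∈ A) ∧ φ (p u) ≠ 0}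
  have hS : S.Nonempty := ⟨⊤, LieModuleHom.id, fun _ => trivial, hu⟩
  obtain ⟨A, ⟨p, hpA, hpu⟩, hmin⟩ := WellFounded.has_min
    (LieSubmodule.wellFoundedLT_of_isArtinian 𝕜 L V).wf S hS
  refine ⟨A, p, fun N hNA hN => ?_, hpA, hpu⟩
  by_contra hne
  obtain ⟨q, hq⟩ := exists_lieModuleHom_retract N
  let q' : V →ₗ⁅𝕜, L⁆ V := N.incl.comp q
  have hq' (x : V) : q' x = q x := rfl
  have h1 : φ (q' (p u)) = 0 := by
    by_contra h
    exact hmin N ⟨q'.comp p, fun x => (q (p x)).2, h⟩ (lt_of_le_of_ne hNA hne)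
  have h2 : φ (p u - q' (p u)) = 0 := by
    by_contra h
    refine hmin (A ⊓ q'.ker) ⟨p - q'.comp p, fun x => ⟨?_, ?_⟩, h⟩ (lt_of_le_of_ne inf_le_left ?_)
    · exact sub_mem (hpA x) (hNA (q (p x)).2)
    · change q' (p x - q' (p x)) = 0
      rw [map_sub, hq' (q' _), hq' (p x), hq, sub_self]
    · intro h
      refine hN ((LieSubmodule.eq_bot_iff _).mpr fun x hx => ?_)
      have hx' : x ∈ A ⊓ q'.ker := by rw [h]; exact hNA hx
      have : q' x = 0 := hx'.2
      rwa [hq' x, hq ⟨x, hx⟩] at this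
  rw [map_sub, h1, sub_zero] at h2
  exact hpu h2

end CompleteReducibility
end Branching

namespace Branching

open Module LieAlgebra

/-! ### Highest weight modules graded by height -/

section HighestWeight

variable {n : ℕ} {𝔤 : LieSubalgebra ℂ (Matrix (Fin n) (Fin n) ℂ)} [LieAlgebra.IsSimple ℂ 𝔤]
  {H : LieSubalgebra ℂ 𝔤} [H.IsCartanSubalgebra] (b : (IsKilling.rootSystem H).Base)

/-- The sum `𝔫⁻` of the negative root spaces with respect to the base `b`. -/
noncomputable def oppositeNilradical : Submodule ℂ 𝔤 :=
  ⨆ i ∈ {i : H.root | -(IsKilling.rootSystem H).root i ∈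
      AddSubmonoid.closure ((IsKilling.rootSystem H).root '' b.support)},
    (rootSpace H (i : H.root).val).toSubmodule

lemma exists_heightElement : ∃ h₀ : H, ∀ i ∈ b.support, (IsKilling.rootSystem H).root i h₀ = 1 := by
  refine ⟨(evalEquiv ℂ H).symm (b.toWeightBasis.constr ℂ (fun _ => (1 : ℂ))), fun i hi => ?_⟩
  have h := b.toWeightBasis.constr_basis ℂ (fun _ => (1 : ℂ)) ⟨i, hi⟩
  rw [RootPairing.Base.toWeightBasis_apply] at h
  exact (apply_evalEquiv_symm_apply ℂ H _ _).trans h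

/-- An element of the Cartan subalgebra on which all simple roots take the value one. -/
noncomputable def heightElement : H := (exists_heightElement b).choose

/-- The last clause makes heights of positive roots strictly positive, so negative root vectors
strictly lower the height eigenvalue. -/
lemma apply_heightElement {α : Dual ℂ H}
    (hα : α ∈ AddSubmonoid.closure ((IsKilling.rootSystem H).root '' b.support)) :
    ∃ k : ℕ, α (heightElement b) = k ∧ (k = 0 → α = 0) := by
  induction hα using AddSubmonoid.closure_induction with
  | mem x hx =>
    obtain ⟨i, hi, rfl⟩ := hx
    exact ⟨1, ((exists_heightElement b).choose_spec i hi).trans Nat.cast_one.symm, by simp⟩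
  | zero => exact ⟨0, by simp⟩
  | add x y _ _ hx hy =>
    obtain ⟨k, hk, hk'⟩ := hx
    obtain ⟨m, hm, hm'⟩ := hy
    refine ⟨k + m, by simp [hk, hm], fun h => ?_⟩
    rw [hk' (by lia), hm' (by lia), add_zero]

lemma apply_heightElement_pos {i : H.root}
    (hi : (IsKilling.rootSystem H).root i ∈
      AddSubmonoid.closure ((IsKilling.rootSystem H).root '' b.support)) :
    ∃ k : ℕ, i.val (heightElement b) = k + 1 := by
  obtain ⟨k, hk, hk'⟩ := apply_heightElement b hi
  obtain _ | k := k
  · exact absurd (hk' rfl) ((IsKilling.rootSystem H).ne_zero i)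
  · exact ⟨k, by simpa using! hk⟩

lemma apply_heightElement_neg {i : H.root}
    (hi : -(IsKilling.rootSystem H).root i ∈
      AddSubmonoid.closure ((IsKilling.rootSystem H).root '' b.support)) :
    ∃ k : ℕ, i.val (heightElement b) = -(k + 1 : ℂ) := by
  obtain ⟨k, hk, hk'⟩ := apply_heightElement b hi
  obtain _ | k := k
  · exact absurd (neg_eq_zero.mp (hk' rfl)) ((IsKilling.rootSystem H).ne_zero i)
  · refine ⟨k, ?_⟩
    rw [LinearMap.neg_apply, neg_eq_iff_eq_neg] at hk
    simpa using! hk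

lemma triangular_decomposition (x : 𝔤) :
    ∃ f ∈ oppositeNilradical b, ∃ h ∈ H, ∃ e ∈ nilradical b, x = f + (h + e) := by
  have key : (⊤ : Submodule ℂ 𝔤) ≤ oppositeNilradical b ⊔ (H.toSubmodule ⊔ nilradical b) := by
    have htop := LieModule.iSup_genWeightSpace_eq_top' ℂ H 𝔤
    rw [← LieSubmodule.toSubmodule_inj, LieSubmodule.iSup_toSubmodule,
      LieSubmodule.top_toSubmodule] at htop
    rw [← htop, iSup_le_iff]
    intro χ
    by_cases hχ : χ.IsZero
    · refine le_trans ?_ (le_sup_left.trans le_sup_right)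
      rw [hχ.eq]
      intro y hy
      have : y ∈ (rootSpace H (0 : H → ℂ)) := hy
      rwa [rootSpace_zero_eq] at this
    · have hχ' : χ ∈ H.root := by simpa using hχ
      rcases b.root_mem_or_neg_mem ⟨χ, hχ'⟩ with h | h
      · refine le_trans ?_ (le_sup_right.trans le_sup_right)
        exact le_iSup₂_of_le (f := fun (i : H.root) _ => (rootSpace H i.val).toSubmodule)
          ⟨χ, hχ'⟩ h le_rfl
      · refine le_trans ?_ le_sup_left
        exact le_iSup₂_of_le (f := fun (i : H.root) _ => (rootSpace H i.val).toSubmodule)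
          ⟨χ, hχ'⟩ h le_rfl
  obtain ⟨f, hf, y, hy, rfl⟩ := Submodule.mem_sup.mp (key (trivial : x ∈ _))
  obtain ⟨h, hh, e, he, rfl⟩ := Submodule.mem_sup.mp hy
  exact ⟨f, hf, h, hh, e, he, rfl⟩

variable {V : Type*} [AddCommGroup V] [Module ℂ V] [LieRingModule 𝔤 V] [LieModule ℂ 𝔤 V]

/-- Nonzero vectors of weight `l` killed by the positive root spaces. -/
structure IsHighestWeightVec (l : Dual ℂ H) (v : V) : Prop where
  ne_zero : v ≠ 0
  lie_cartan : ∀ h : H, ⁅(h : 𝔤), v⁆ = l h • v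
  lie_nilradical : ∀ X ∈ nilradical b, ⁅X, v⁆ = 0

/-- Functionals of weight `l` vanishing on the image of the negative root spaces. -/
structure IsLowestWeightCovec (l : Dual ℂ H) (ξ : Dual ℂ V) : Prop where
  apply_cartan : ∀ (h : H) (w : V), ξ ⁅(h : 𝔤), w⁆ = l h * ξ w
  apply_nilradical : ∀ X ∈ oppositeNilradical b, ∀ w : V, ξ ⁅X, w⁆ = 0

variable {b} {l : Dual ℂ H} {v : V}

/-- A highest weight module is generated by its highest weight vector under `𝔫⁻`. -/
lemma eq_top_of_lowering_stable (hv : IsHighestWeightVec b l v)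
    (hgen : ∀ N : LieSubmodule ℂ 𝔤 V, v ∈ N → N = ⊤) (T : Submodule ℂ V) (hvT : v ∈ T)
    (hT : ∀ X ∈ oppositeNilradical b, ∀ w ∈ T, ⁅X, w⁆ ∈ T) : T = ⊤ := by
  let 𝒮 : Set (Submodule ℂ V) :=
    {T | v ∈ T ∧ ∀ X ∈ oppositeNilradical b, ∀ w ∈ T, ⁅X, w⁆ ∈ T}
  let N := sInf 𝒮
  have hvN : v ∈ N := Submodule.mem_sInf.mpr fun T hT => hT.1
  have hN : ∀ X ∈ oppositeNilradical b, ∀ w ∈ N, ⁅X, w⁆ ∈ N := fun X hX w hw =>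
    Submodule.mem_sInf.mpr fun T hT => hT.2 X hX w (Submodule.mem_sInf.mp hw T hT)
  -- `N'` is the part of `N` that the Borel subalgebra sends back into `N`. It contains `v`, and it
  -- is stable under `𝔫⁻` because `⁅h + e, X⁆` again splits by the triangular decomposition.
  -- Minimality gives `N = N'`, so `N` is a Lie submodule.
  let N' : Submodule ℂ V :=
    { carrier := {w | w ∈ N ∧ ∀ h ∈ H, ∀ e ∈ nilradical b, ⁅h + e, w⁆ ∈ N}
      add_mem' := fun hx hy => ⟨add_mem hx.1 hy.1, fun h hh e he => by
        rw [lie_add]; exact add_mem (hx.2 h hh e he) (hy.2 h hh e he)⟩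
      zero_mem' := ⟨zero_mem _, fun h hh e he => by rw [lie_zero]; exact zero_mem _⟩
      smul_mem' := fun c x hx => ⟨N.smul_mem c hx.1, fun h hh e he => by
        rw [lie_smul]; exact N.smul_mem c (hx.2 h hh e he)⟩ }
  have hN' : N' ∈ 𝒮 := by
    refine ⟨⟨hvN, fun h hh e he => ?_⟩, fun X hX w hw => ⟨hN X hX w hw.1, fun h hh e he => ?_⟩⟩
    · rw [add_lie, hv.lie_nilradical e he, add_zero, hv.lie_cartan ⟨h, hh⟩]
      exact N.smul_mem _ hvN
    · obtain ⟨f', hf', h', hh', e', he', heq⟩ := triangular_decomposition b ⁅h + e, X⁆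
      rw [leibniz_lie, heq, add_lie]
      exact add_mem (add_mem (hN f' hf' w hw.1) (hw.2 h' hh' e' he')) (hN X hX _ (hw.2 h hh e he))
  have hle : N ≤ N' := sInf_le hN'
  let N₁ : LieSubmodule ℂ 𝔤 V :=
    { N with
      lie_mem := fun {x w} hw => by
        have hw : w ∈ N := hw
        obtain ⟨f', hf', h', hh', e', he', heq⟩ := triangular_decomposition b x
        change ⁅x, w⁆ ∈ N
        rw [heq, add_lie]
        exact add_mem (hN f' hf' w hw) ((hle hw).2 h' hh' e' he') }
  have h1 := hgen N₁ hvN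
  rw [eq_top_iff]
  intro w _
  have hw : w ∈ N₁ := by rw [h1]; trivial
  have hw : w ∈ N := hw
  exact Submodule.mem_sInf.mp hw T ⟨hvT, hT⟩

/-- The sum of the eigenspaces of the height element strictly below a given value. -/
noncomputable def lowerPart (V : Type*) [AddCommGroup V] [Module ℂ V] [LieRingModule 𝔤 V]
    [LieModule ℂ 𝔤 V] (b : (IsKilling.rootSystem H).Base) (c : ℂ) : Submodule ℂ V :=
  ⨆ k : ℕ, (LieModule.toEnd ℂ 𝔤 V (heightElement b : 𝔤)).eigenspace (c - (k + 1))

lemma lie_mem_eigenspace {i : H.root} {X : 𝔤} (hX : X ∈ rootSpace H i.val) {c : ℂ} {w : V}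
    (hw : w ∈ (LieModule.toEnd ℂ 𝔤 V (heightElement b : 𝔤)).eigenspace c) :
    ⁅X, w⁆ ∈ (LieModule.toEnd ℂ 𝔤 V (heightElement b : 𝔤)).eigenspace
      (i.val (heightElement b) + c) := by
  rw [End.mem_eigenspace_iff, LieModule.toEnd_apply_apply] at hw ⊢
  have h := IsKilling.lie_eq_smul_of_mem_rootSpace hX (heightElement b)
  rw [leibniz_lie, hw, lie_smul]
  have : ⁅(heightElement b : 𝔤), X⁆ = i.val (heightElement b) • X := h
  rw [this, smul_lie, add_smul]

lemma lie_mem_lowerPart {X : 𝔤} (hX : X ∈ oppositeNilradical b) {c : ℂ} {w : V}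
    (hw : w ∈ (LieModule.toEnd ℂ 𝔤 V (heightElement b : 𝔤)).eigenspace c ⊔ lowerPart V b c) :
    ⁅X, w⁆ ∈ lowerPart V b c := by
  have main (j : ℂ) (w : V) (hj : j = c ∨ ∃ k : ℕ, j = c - (k + 1))
      (hw : w ∈ (LieModule.toEnd ℂ 𝔤 V (heightElement b : 𝔤)).eigenspace j) :
      ⁅X, w⁆ ∈ lowerPart V b c := by
    have : oppositeNilradical b ≤ (lowerPart V b c).comap
        ((LieModule.toEnd ℂ 𝔤 V : 𝔤 →ₗ[ℂ] End ℂ V).flip w) := by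
      refine iSup₂_le fun i hi Y hY => ?_
      obtain ⟨k, hk⟩ := apply_heightElement_neg b hi
      have h1 := lie_mem_eigenspace (b := b) hY hw
      change ⁅Y, w⁆ ∈ lowerPart V b c
      rw [hk] at h1
      obtain rfl | ⟨m, rfl⟩ := hj
      · refine Submodule.mem_iSup_of_mem k ?_
        convert h1 using 2
        ring
      · refine Submodule.mem_iSup_of_mem (k + m + 1) ?_
        convert h1 using 2
        push_cast
        ring
    exact this hX
  have h2 : (LieModule.toEnd ℂ 𝔤 V (heightElement b : 𝔤)).eigenspace c ⊔ lowerPart V b c ≤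
      (lowerPart V b c).comap (LieModule.toEnd ℂ 𝔤 V X) :=
    sup_le (fun w hw => main c w (Or.inl rfl) hw)
      (iSup_le fun k w hw => main _ w (Or.inr ⟨k, rfl⟩) hw)
  exact h2 hw

lemma disjoint_lowerPart (c : ℂ) :
    Disjoint ((LieModule.toEnd ℂ 𝔤 V (heightElement b : 𝔤)).eigenspace c) (lowerPart V b c) := by
  have h := (LieModule.toEnd ℂ 𝔤 V (heightElement b : 𝔤)).eigenspaces_iSupIndep c
  refine h.mono_right (iSup_le fun k => le_iSup₂_of_le (c - (k + 1)) ?_ le_rfl)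
  intro h
  have : (k : ℂ) + 1 = 0 := by linear_combination -h
  exact Nat.cast_add_one_ne_zero k this

lemma IsHighestWeightVec.mem_eigenspace (hv : IsHighestWeightVec b l v) :
    v ∈ (LieModule.toEnd ℂ 𝔤 V (heightElement b : 𝔤)).eigenspace (l (heightElement b)) := by
  rw [End.mem_eigenspace_iff]
  exact hv.lie_cartan _

/-- The left side contains `v` and is stable under `𝔫⁻`, which moves everything strictly down in
height. -/
lemma IsHighestWeightVec.span_sup_lowerPart (hv : IsHighestWeightVec b l v)
    (hgen : ∀ N : LieSubmodule ℂ 𝔤 V, v ∈ N → N = ⊤) :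
    (ℂ ∙ v) ⊔ lowerPart V b (l (heightElement b)) = ⊤ := by
  refine eq_top_of_lowering_stable hv hgen _
    (Submodule.mem_sup_left (Submodule.mem_span_singleton_self v)) fun X hX w hw => ?_
  refine Submodule.mem_sup_right (lie_mem_lowerPart hX ?_)
  have hle : (ℂ ∙ v) ≤ (LieModule.toEnd ℂ 𝔤 V (heightElement b : 𝔤)).eigenspace
      (l (heightElement b)) := by
    rw [Submodule.span_singleton_le_iff_mem]
    exact hv.mem_eigenspace
  exact (sup_le_sup hle le_rfl : _ ≤ _ ⊔ lowerPart V b _) hw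

/-- The weight space of the highest weight is one-dimensional. -/
lemma IsHighestWeightVec.exists_eq_smul (hv : IsHighestWeightVec b l v)
    (hgen : ∀ N : LieSubmodule ℂ 𝔤 V, v ∈ N → N = ⊤) {w : V}
    (hw : ⁅(heightElement b : 𝔤), w⁆ = l (heightElement b) • w) : ∃ a : ℂ, w = a • v := by
  have h : w ∈ (⊤ : Submodule ℂ V) := trivial
  rw [← hv.span_sup_lowerPart hgen] at h
  obtain ⟨y, hy, e, he, rfl⟩ := Submodule.mem_sup.mp h
  obtain ⟨a, rfl⟩ := Submodule.mem_span_singleton.mp hy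
  refine ⟨a, ?_⟩
  have h1 : e ∈ (LieModule.toEnd ℂ 𝔤 V (heightElement b : 𝔤)).eigenspace
      (l (heightElement b)) := by
    rw [← add_sub_cancel_left (a • v) e]
    exact sub_mem (End.mem_eigenspace_iff.mpr hw) (Submodule.smul_mem _ _ hv.mem_eigenspace)
  rw [Submodule.disjoint_def.mp (disjoint_lowerPart _) e h1 he, add_zero]

/-- A highest weight module has a lowest weight covector of the same weight. -/
lemma IsHighestWeightVec.exists_covec (hv : IsHighestWeightVec b l v)
    (hgen : ∀ N : LieSubmodule ℂ 𝔤 V, v ∈ N → N = ⊤) :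
    ∃ ξ : Dual ℂ V, ξ v = 1 ∧ IsLowestWeightCovec b l ξ := by
  have hvE : v ∉ lowerPart V b (l (heightElement b)) := fun h =>
    hv.ne_zero (Submodule.disjoint_def.mp (disjoint_lowerPart _) v hv.mem_eigenspace h)
  obtain ⟨ξ, hξv, hξ⟩ := Submodule.exists_le_ker_of_notMem hvE
  have hξE (w : V) (hw : w ∈ lowerPart V b (l (heightElement b))) : ξ w = 0 := hξ hw
  have hall (w : V) : ∃ a : ℂ, ∃ e ∈ lowerPart V b (l (heightElement b)), w = a • v + e := by
    have h : w ∈ (⊤ : Submodule ℂ V) := trivial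
    rw [← hv.span_sup_lowerPart hgen] at h
    obtain ⟨y, hy, e, he, rfl⟩ := Submodule.mem_sup.mp h
    obtain ⟨a, rfl⟩ := Submodule.mem_span_singleton.mp hy
    exact ⟨a, e, he, rfl⟩
  refine ⟨(ξ v)⁻¹ • ξ, by simp [hξv], fun h w => ?_, fun X hX w => ?_⟩
  -- The Cartan subalgebra is abelian, hence commutes with the height element and preserves its
  -- eigenspaces.
  · have hE : lowerPart V b (l (heightElement b)) ≤ (lowerPart V b (l (heightElement b))).comap
        (LieModule.toEnd ℂ 𝔤 V (h : 𝔤)) := by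
      refine iSup_le fun k w hw => Submodule.mem_iSup_of_mem k ?_
      rw [End.mem_eigenspace_iff, LieModule.toEnd_apply_apply] at hw
      rw [End.mem_eigenspace_iff, LieModule.toEnd_apply_apply, LieModule.toEnd_apply_apply,
        leibniz_lie, hw, lie_smul]
      have : ⁅(heightElement b : 𝔤), (h : 𝔤)⁆ = 0 :=
        congrArg Subtype.val (trivial_lie_zero H H (heightElement b) h)
      rw [this, zero_lie, zero_add]
    obtain ⟨a, e, he, rfl⟩ := hall w
    have h1 : ξ ⁅(h : 𝔤), e⁆ = 0 := hξE _ (hE he)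
    simp only [LinearMap.smul_apply, lie_add, lie_smul, hv.lie_cartan, map_add, map_smul, h1,
      hξE e he, smul_eq_mul]
    ring
  · rw [LinearMap.smul_apply, hξE _ (lie_mem_lowerPart hX ?_), smul_zero]
    obtain ⟨a, e, he, rfl⟩ := hall w
    exact add_mem (Submodule.mem_sup_left (Submodule.smul_mem _ _ hv.mem_eigenspace))
      (Submodule.mem_sup_right he)

/-- A nonzero lowest weight covector on a highest weight module has the same weight. -/
lemma IsHighestWeightVec.weight_eq (hv : IsHighestWeightVec b l v)
    (hgen : ∀ N : LieSubmodule ℂ 𝔤 V, v ∈ N → N = ⊤) {l' : Dual ℂ H} {η : Dual ℂ V}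
    (hη : IsLowestWeightCovec b l' η) (hη0 : η ≠ 0) : l' = l := by
  -- If `η v = 0`, then `ker η` would contain `v` and be stable under `𝔫⁻`, hence be everything.
  have hηv : η v ≠ 0 := by
    intro h
    refine hη0 (LinearMap.ker_eq_top.mp ?_)
    exact eq_top_of_lowering_stable hv hgen _ h fun X hX w _ => hη.apply_nilradical X hX w
  ext h
  have h1 := hη.apply_cartan h v
  rw [hv.lie_cartan, map_smul, smul_eq_mul] at h1
  exact (mul_right_cancel₀ hηv h1).symm

end HighestWeight
end Branching

namespace Branching

open Module LieAlgebra

/-! ### Existence of highest weight vectors and uniqueness of irreducible modules -/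

section ProdModule

variable {R L M N : Type*} [CommRing R] [LieRing L] [LieAlgebra R L] [AddCommGroup M] [Module R M]
  [LieRingModule L M] [LieModule R L M] [AddCommGroup N] [Module R N] [LieRingModule L N]
  [LieModule R L N]

/-- The product of two Lie modules. -/
@[reducible] def prodLieRingModule : LieRingModule L (M × N) where
  bracket x m := (⁅x, m.1⁆, ⁅x, m.2⁆)
  add_lie x y m := Prod.ext (add_lie x y m.1) (add_lie x y m.2)
  lie_add x m m' := Prod.ext (lie_add x m.1 m'.1) (lie_add x m.2 m'.2)
  leibniz_lie x y m := Prod.ext (leibniz_lie x y m.1) (leibniz_lie x y m.2)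

attribute [local instance] prodLieRingModule

lemma prodLieModule : LieModule R L (M × N) where
  smul_lie t x m := Prod.ext (smul_lie t x m.1) (smul_lie t x m.2)
  lie_smul t x m := Prod.ext (lie_smul t x m.1) (lie_smul t x m.2)

end ProdModule

section HighestWeight

variable {n : ℕ} {𝔤 : LieSubalgebra ℂ (Matrix (Fin n) (Fin n) ℂ)} [LieAlgebra.IsSimple ℂ 𝔤]
  {H : LieSubalgebra ℂ 𝔤} [H.IsCartanSubalgebra] (b : (IsKilling.rootSystem H).Base)
  {V : Type*} [AddCommGroup V] [Module ℂ V] [LieRingModule 𝔤 V] [LieModule ℂ 𝔤 V]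

lemma exists_isHighestWeightVec [FiniteDimensional ℂ V] [Nontrivial V] :
    ∃ (l : Dual ℂ H) (v : V), IsHighestWeightVec b l v := by
  have hne : Nonempty (LieModule.Weight ℂ H V) := by
    by_contra hemp
    rw [not_nonempty_iff] at hemp
    have h := LieModule.iSup_genWeightSpace_eq_top' ℂ H V
    rw [iSup_of_empty] at h
    exact bot_ne_top h
  -- A positive root vector would produce a weight whose height has strictly larger real part, so it
  -- kills a simultaneous eigenvector of a maximal weight.
  obtain ⟨χ, hχ⟩ := Finite.exists_max fun χ : LieModule.Weight ℂ H V => (χ (heightElement b)).re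
  obtain ⟨v, hv0, hv⟩ := LieModule.exists_forall_lie_eq_smul ℂ H V χ
  refine ⟨χ.toLinear, v, hv0, hv, fun X hX => ?_⟩
  have : nilradical b ≤ LinearMap.ker ((LieModule.toEnd ℂ 𝔤 V : 𝔤 →ₗ[ℂ] End ℂ V).flip v) := by
    refine iSup₂_le fun i hi Y hY => ?_
    change ⁅Y, v⁆ = 0
    by_contra hYv
    have hmem : v ∈ LieModule.genWeightSpace V χ := by
      refine LieModule.weightSpace_le_genWeightSpace V χ ?_
      rw [LieModule.mem_weightSpace]
      exact hv
    have h1 := LieAlgebra.lie_mem_genWeightSpace_of_mem_genWeightSpace hY hmem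
    have h2 : LieModule.genWeightSpace V (i.val + χ : H → ℂ) ≠ ⊥ := by
      intro h
      rw [h] at h1
      exact hYv (by simpa using h1)
    obtain ⟨k, hk⟩ := apply_heightElement_pos b hi
    have h3 := hχ ⟨i.val + χ, h2⟩
    have h4 : ((i.val : H → ℂ) + χ) (heightElement b) = (k + 1) + χ (heightElement b) := by
      rw [Pi.add_apply, hk]
    change (((i.val : H → ℂ) + χ) (heightElement b)).re ≤ _ at h3
    rw [h4] at h3
    simp at h3
    have : (0 : ℝ) ≤ k := Nat.cast_nonneg k
    linarith
  exact this hX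

variable {b} {U : Type*} [AddCommGroup U] [Module ℂ U] [LieRingModule 𝔤 U] [LieModule ℂ 𝔤 U]

-- The submodule `N` of `U × V` generated by `(u, v)` is the graph of the desired map. It is a
-- highest weight module, so its top weight space is the line through `(u, v)`. This excludes `(0,
-- v)`, and the projection of `N` to `U` is bijective.
attribute [local instance] prodLieRingModule prodLieModule in
lemma exists_lieModuleHom_of_vec [LieModule.IsIrreducible ℂ 𝔤 U] [LieModule.IsIrreducible ℂ 𝔤 V]
    {l : Dual ℂ H} {u : U} {v : V} (hu : IsHighestWeightVec b l u)
    (hv : IsHighestWeightVec b l v) : ∃ f : U →ₗ⁅ℂ, 𝔤⁆ V, f u = v := by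
  let N : LieSubmodule ℂ 𝔤 (U × V) := LieSubmodule.lieSpan ℂ 𝔤 {(u, v)}
  have huv : (u, v) ∈ N := LieSubmodule.subset_lieSpan rfl
  let w : N := ⟨(u, v), huv⟩
  have hw : IsHighestWeightVec b l w :=
    { ne_zero := fun h => hu.ne_zero (congrArg (fun x : N => x.1.1) h)
      lie_cartan := fun h => Subtype.ext (Prod.ext (hu.lie_cartan h) (hv.lie_cartan h))
      lie_nilradical := fun X hX =>
        Subtype.ext (Prod.ext (hu.lie_nilradical X hX) (hv.lie_nilradical X hX)) }
  have hgen (M : LieSubmodule ℂ 𝔤 N) (hM : w ∈ M) : M = ⊤ := by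
    have h1 : N ≤ M.map N.incl := by
      rw [LieSubmodule.lieSpan_le, Set.singleton_subset_iff]
      exact ⟨w, hM, rfl⟩
    rw [eq_top_iff]
    rintro x -
    obtain ⟨y, hy, hyx⟩ := h1 x.2
    have : y = x := Subtype.ext hyx
    rwa [← this]
  let π₁ : N →ₗ⁅ℂ, 𝔤⁆ U :=
    { LinearMap.fst ℂ U V ∘ₗ N.toSubmodule.subtype with map_lie' := rfl }
  let π₂ : N →ₗ⁅ℂ, 𝔤⁆ V :=
    { LinearMap.snd ℂ U V ∘ₗ N.toSubmodule.subtype with map_lie' := rfl }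
  have hinj : Function.Injective π₁ := by
    let A : LieSubmodule ℂ 𝔤 V :=
      { N.toSubmodule.comap (LinearMap.inr ℂ U V) with
        lie_mem := fun {x m} hm => by
          have hm : ((0 : U), m) ∈ N := hm
          have := N.lie_mem (x := x) hm
          change ((0 : U), ⁅x, m⁆) ∈ N
          have h0 : ((0 : U), ⁅x, m⁆) = ⁅x, ((0 : U), m)⁆ := Prod.ext (lie_zero x).symm rfl
          rwa [h0] }
    have hA : A = ⊥ := by
      refine (eq_bot_or_eq_top A).resolve_right fun hA => ?_
      have hvA : v ∈ A := by rw [hA]; trivial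
      have h0v : ((0 : U), v) ∈ N := hvA
      obtain ⟨a, ha⟩ := hw.exists_eq_smul hgen (w := ⟨(0, v), h0v⟩)
        (Subtype.ext (Prod.ext ((lie_zero _).trans (smul_zero _).symm)
          (hv.lie_cartan _)))
      have h1 : (0 : U) = a • u := congrArg (fun x : N => x.1.1) ha
      have h2 : v = a • v := congrArg (fun x : N => x.1.2) ha
      have : a = 0 := (smul_eq_zero.mp h1.symm).resolve_right hu.ne_zero
      rw [this, zero_smul] at h2
      exact hv.ne_zero h2
    rw [injective_iff_map_eq_zero]
    rintro ⟨⟨x, y⟩, hxy⟩ h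
    have hx : x = 0 := h
    subst hx
    have : y ∈ A := hxy
    rw [hA] at this
    have hy : y = 0 := by simpa using this
    subst hy
    rfl
  have hsurj : Function.Surjective π₁ := by
    have : π₁.range = ⊤ := by
      refine (eq_bot_or_eq_top π₁.range).resolve_left fun h => hu.ne_zero ?_
      have : u ∈ π₁.range := ⟨w, rfl⟩
      rw [h] at this
      simpa using this
    exact (LieModuleHom.range_eq_top π₁).mp this
  let e : N ≃ₗ⁅ℂ, 𝔤⁆ U := { LinearEquiv.ofBijective (π₁ : N →ₗ[ℂ] U) ⟨hinj, hsurj⟩ with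
    map_lie' := fun {x m} => π₁.map_lie x m }
  refine ⟨π₂.comp e.symm.toLieModuleHom, ?_⟩
  have : e.symm u = w := (LinearEquiv.symm_apply_eq e.toLinearEquiv).mpr rfl
  change π₂ (e.symm u) = v
  rw [this]
  rfl

/-- Irreducible modules with the same highest weight are isomorphic, where on one side the weight
is detected by a lowest weight covector. -/
theorem exists_injective_lieModuleHom [FiniteDimensional ℂ U] [LieModule.IsIrreducible ℂ 𝔤 U]
    [LieModule.IsIrreducible ℂ 𝔤 V] {l : Dual ℂ H} {η : Dual ℂ U} (hη : IsLowestWeightCovec b l η)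
    (hη0 : η ≠ 0) {v : V} (hv : IsHighestWeightVec b l v) :
    ∃ f : U →ₗ⁅ℂ, 𝔤⁆ V, Function.Injective f := by
  have := LieModule.nontrivial_of_isIrreducible ℂ 𝔤 U
  obtain ⟨l', u, hu⟩ := exists_isHighestWeightVec b (V := U)
  have hl : l = l' := hu.weight_eq (fun N hN => ?_) hη hη0
  · subst hl
    obtain ⟨f, hf⟩ := exists_lieModuleHom_of_vec hu hv
    refine ⟨f, ?_⟩
    have : f.ker = ⊥ := by
      refine (eq_bot_or_eq_top f.ker).resolve_right fun h => hv.ne_zero ?_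
      have : u ∈ f.ker := by rw [h]; trivial
      rw [← hf]
      exact this
    exact f.ker_eq_bot.mp this
  · refine (eq_bot_or_eq_top N).resolve_left fun h => hu.ne_zero ?_
    rw [h] at hN
    simpa using hN

end HighestWeight
end Branching

namespace Branching

open Module LieAlgebra

/-! ### The differential of a rational representation -/

section Differential

open scoped Matrix.Norms.Operator

variable {n : ℕ}

/-- The value of a regular expression at a matrix. -/
noncomputable def regularEval (p : MvPolynomial (Option (Fin n × Fin n)) ℂ)
    (A : Matrix (Fin n) (Fin n) ℂ) : ℂ :=
  MvPolynomial.eval (fun o => o.elim A.det⁻¹ (fun ij => A ij.1 ij.2)) p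

lemma differentiable_entry (i j : Fin n) :
    Differentiable ℂ (fun A : Matrix (Fin n) (Fin n) ℂ => A i j) :=
  (LinearMap.toContinuousLinearMap (Matrix.entryLinearMap ℂ ℂ i j)).differentiable

lemma differentiable_det : Differentiable ℂ (fun A : Matrix (Fin n) (Fin n) ℂ => A.det) := by
  simp only [Matrix.det_apply']
  refine Differentiable.fun_sum fun σ _ => Differentiable.const_mul ?_ _
  rw [show (fun A : Matrix (Fin n) (Fin n) ℂ => ∏ i, A (σ i) i) = ∏ i, fun A => A (σ i) i by
    ext; simp]
  exact Finset.prod_induction _ (Differentiable ℂ) (fun _ _ ha hb => ha.mul hb)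
    (differentiable_const 1) fun i _ => differentiable_entry (σ i) i

lemma differentiableAt_regularEval (p : MvPolynomial (Option (Fin n × Fin n)) ℂ)
    {A : Matrix (Fin n) (Fin n) ℂ} (hA : A.det ≠ 0) : DifferentiableAt ℂ (regularEval p) A := by
  unfold regularEval
  induction p using MvPolynomial.induction_on with
  | C a => simp
  | add p q hp hq =>
    simp only [map_add]
    exact hp.add hq
  | mul_X p o hp =>
    simp only [map_mul, MvPolynomial.eval_X]
    refine hp.mul ?_
    cases o with
    | none => exact (differentiable_det A).inv hA
    | some ij => exact differentiable_entry _ _ A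

lemma hasDerivAt_of_eq {f g : ℂ → ℂ} {a b t : ℂ} (h : HasDerivAt f a t) (hfg : ∀ s, g s = f s)
    (hab : b = a) : HasDerivAt g b t := by
  rw [hab, show g = f from funext hfg]
  exact h

lemma hasDerivAt_matrix_exp (X : Matrix (Fin n) (Fin n) ℂ) (t : ℂ) :
    HasDerivAt (fun t : ℂ => NormedSpace.exp (t • X)) (NormedSpace.exp (t • X) * X) t :=
  hasDerivAt_exp_smul_const X t

variable {G : Subgroup (GL (Fin n) ℂ)} {𝔤 : LieSubalgebra ℂ (Matrix (Fin n) (Fin n) ℂ)}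
  (h𝔤 : IsLieAlgebraOf 𝔤 G)

include h𝔤 in
lemma exists_expElt (X : 𝔤) : ∃ g : G, g.val.val = NormedSpace.exp (X : Matrix (Fin n) (Fin n) ℂ) := by
  obtain ⟨g, hg, h⟩ := (h𝔤 X).mp X.2 1
  exact ⟨⟨g, hg⟩, by rw [h, one_smul]⟩

/-- The exponential map from the Lie algebra to the group. -/
noncomputable def expElt (X : 𝔤) : G := (exists_expElt h𝔤 X).choose

lemma coe_expElt (X : 𝔤) :
    (expElt h𝔤 X).val.val = NormedSpace.exp (X : Matrix (Fin n) (Fin n) ℂ) :=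
  (exists_expElt h𝔤 X).choose_spec

lemma coe_expElt_smul (t : ℂ) (X : 𝔤) :
    (expElt h𝔤 (t • X)).val.val = NormedSpace.exp (t • (X : Matrix (Fin n) (Fin n) ℂ)) :=
  coe_expElt h𝔤 _

lemma eq_expElt {g : G} {X : 𝔤} (h : g.val.val = NormedSpace.exp (X : Matrix (Fin n) (Fin n) ℂ)) :
    g = expElt h𝔤 X :=
  Subtype.ext (Units.ext (h.trans (coe_expElt h𝔤 X).symm))

lemma expElt_zero : expElt h𝔤 (0 : 𝔤) = 1 :=
  (eq_expElt h𝔤 (by simp [NormedSpace.exp_zero])).symm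

lemma expElt_add_smul (s t : ℂ) (X : 𝔤) :
    expElt h𝔤 ((s + t) • X) = expElt h𝔤 (s • X) * expElt h𝔤 (t • X) := by
  refine (eq_expElt h𝔤 ?_).symm
  rw [Subgroup.coe_mul, Units.val_mul, coe_expElt_smul, coe_expElt_smul,
    ← Matrix.exp_add_of_commute _ _ ((Commute.refl _).smul_left s |>.smul_right t), ← add_smul]
  rfl

lemma IsRegular.hasDerivAt {f : G → ℂ} {p : MvPolynomial (Option (Fin n × Fin n)) ℂ}
    (hf : ∀ g : G, f g = regularEval p g.val.val) (X : 𝔤) :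
    HasDerivAt (fun t : ℂ => f (expElt h𝔤 (t • X))) (fderiv ℂ (regularEval p) 1 X) 0 := by
  simp only [hf, coe_expElt_smul]
  have h1 := hasDerivAt_matrix_exp (X : Matrix (Fin n) (Fin n) ℂ) 0
  rw [zero_smul, NormedSpace.exp_zero, one_mul] at h1
  have h2 : HasFDerivAt (regularEval p) (fderiv ℂ (regularEval p) 1)
      (NormedSpace.exp ((0 : ℂ) • (X : Matrix (Fin n) (Fin n) ℂ))) := by
    rw [zero_smul, NormedSpace.exp_zero]
    exact (differentiableAt_regularEval p (by simp)).hasFDerivAt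
  exact h2.comp_hasDerivAt (0 : ℂ) h1

variable {V : Type*} [AddCommGroup V] [Module ℂ V] [FiniteDimensional ℂ V]
  {ρ : Representation ℂ G V} (hρ : IsRational ρ)

/-- The derivative at the identity of the orbit map along a one-parameter subgroup. -/
noncomputable def orbitDeriv (ρ : Representation ℂ G V) (X : 𝔤) (v : V) : V :=
  ∑ i, deriv (fun t : ℂ => (finBasis ℂ V).coord i (ρ (expElt h𝔤 (t • X)) v)) 0 • finBasis ℂ V i

include hρ in
lemma hasDerivAt_zero (X : 𝔤) (φ : Dual ℂ V) (v : V) :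
    HasDerivAt (fun t : ℂ => φ (ρ (expElt h𝔤 (t • X)) v)) (φ (orbitDeriv h𝔤 ρ X v)) 0 := by
  have h1 (i) : HasDerivAt (fun t : ℂ => (finBasis ℂ V).coord i (ρ (expElt h𝔤 (t • X)) v))
      (deriv (fun t : ℂ => (finBasis ℂ V).coord i (ρ (expElt h𝔤 (t • X)) v)) 0) 0 := by
    obtain ⟨p, hp⟩ := hρ ((finBasis ℂ V).coord i) v
    exact (IsRegular.hasDerivAt h𝔤 hp X).differentiableAt.hasDerivAt
  have h2 := HasDerivAt.fun_sum (u := Finset.univ) fun i _ => (h1 i).mul_const (φ (finBasis ℂ V i))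
  refine hasDerivAt_of_eq h2 (fun t => ?_) (by simp [orbitDeriv])
  conv_lhs => rw [← (finBasis ℂ V).sum_repr (ρ (expElt h𝔤 (t • X)) v)]
  simp only [map_sum, map_smul, smul_eq_mul, Basis.coord_apply]

lemma eq_of_forall_dual {v w : V} (h : ∀ φ : Dual ℂ V, φ v = φ w) : v = w := by
  rw [← sub_eq_zero, ← forall_dual_apply_eq_zero_iff ℂ]
  intro φ
  rw [map_sub, h, sub_self]

-- The derivative along `exp (t X)` is the Fréchet derivative at `1` of a regular expression in the
-- matrix, applied to `X`. Linearity of the differential in `X` follows.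
include hρ in
lemma exists_fderiv (φ : Dual ℂ V) (v : V) :
    ∃ D : Matrix (Fin n) (Fin n) ℂ →L[ℂ] ℂ, ∀ X : 𝔤, φ (orbitDeriv h𝔤 ρ X v) = D X := by
  obtain ⟨p, hp⟩ := hρ φ v
  exact ⟨_, fun X => (hasDerivAt_zero h𝔤 hρ X φ v).unique (IsRegular.hasDerivAt h𝔤 hp X)⟩

/-- The differential of a rational representation, as a linear map. -/
noncomputable def differentialLinear : 𝔤 →ₗ[ℂ] End ℂ V where
  toFun X :=
    { toFun := orbitDeriv h𝔤 ρ X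
      map_add' := fun v w => eq_of_forall_dual fun φ => by
        refine (hasDerivAt_zero h𝔤 hρ X φ _).unique ?_
        simpa using (hasDerivAt_zero h𝔤 hρ X φ v).fun_add (hasDerivAt_zero h𝔤 hρ X φ w)
      map_smul' := fun c v => eq_of_forall_dual fun φ => by
        refine (hasDerivAt_zero h𝔤 hρ X φ _).unique ?_
        simpa using (hasDerivAt_zero h𝔤 hρ X φ v).const_mul c }
  map_add' X Y := LinearMap.ext fun v => eq_of_forall_dual fun φ => by
    obtain ⟨D, hD⟩ := exists_fderiv h𝔤 hρ φ v
    simp [hD]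
  map_smul' c X := LinearMap.ext fun v => eq_of_forall_dual fun φ => by
    obtain ⟨D, hD⟩ := exists_fderiv h𝔤 hρ φ v
    simp [hD]

lemma hasDerivAt_orbit (X : 𝔤) (φ : Dual ℂ V) (v : V) (t : ℂ) :
    HasDerivAt (fun t : ℂ => φ (ρ (expElt h𝔤 (t • X)) v))
      (φ (ρ (expElt h𝔤 (t • X)) (differentialLinear h𝔤 hρ X v))) t := by
  have h1 := hasDerivAt_zero h𝔤 hρ X (φ ∘ₗ ρ (expElt h𝔤 (t • X))) v
  rw [← sub_self t] at h1
  refine hasDerivAt_of_eq (h1.comp_sub_const t t) (fun s => ?_) rfl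
  rw [LinearMap.comp_apply, ← Module.End.mul_apply, ← map_mul, ← expElt_add_smul, add_sub_cancel]

lemma differential_conj (g : G) (X Y : 𝔤)
    (hY : (Y : Matrix (Fin n) (Fin n) ℂ) = g.val.val * X * (g⁻¹).val.val) (v : V) :
    differentialLinear h𝔤 hρ Y (ρ g v) = ρ g (differentialLinear h𝔤 hρ X v) := by
  have hexp (t : ℂ) : expElt h𝔤 (t • Y) * g = g * expElt h𝔤 (t • X) := by
    rw [← eq_mul_inv_iff_mul_eq]
    refine (eq_expElt h𝔤 ?_).symm
    simp only [Subgroup.coe_mul, Units.val_mul, coe_expElt_smul]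
    have := Matrix.exp_units_conj g.val (t • (X : Matrix (Fin n) (Fin n) ℂ))
    rw [Subgroup.coe_inv, ← this, show ((t • Y : 𝔤) : Matrix (Fin n) (Fin n) ℂ) = t • Y.val from rfl,
      hY]
    simp
  refine eq_of_forall_dual fun φ => ?_
  refine (hasDerivAt_zero h𝔤 hρ Y φ (ρ g v)).unique ?_
  have := hasDerivAt_zero h𝔤 hρ X (φ ∘ₗ ρ g) v
  refine hasDerivAt_of_eq this (fun t => ?_) rfl
  rw [LinearMap.comp_apply, ← Module.End.mul_apply, ← map_mul, hexp, map_mul, Module.End.mul_apply]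

include h𝔤 in
lemma conj_exp_mem (g : G) (X : 𝔤) : g.val.val * X * (g⁻¹).val.val ∈ 𝔤 := by
  rw [h𝔤]
  intro t
  refine ⟨g * expElt h𝔤 (t • X) * g⁻¹, SetLike.coe_mem (g * expElt h𝔤 (t • X) * g⁻¹), ?_⟩
  have := Matrix.exp_units_conj g.val (t • (X : Matrix (Fin n) (Fin n) ℂ))
  simp only [Units.val_mul, coe_expElt_smul]
  rw [Subgroup.coe_inv, ← this]
  simp

/-- Put `γ t = exp (tX) Y exp (-tX)` and differentiate `dρ(γ t) ρ(exp tX) v = ρ(exp tX) dρ(Y) v` at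
`t = 0`. Since `γ' 0 = ⁅X, Y⁆`, the product rule gives the bracket relation. -/
lemma differential_lie (X Y : 𝔤) (v : V) :
    differentialLinear h𝔤 hρ ⁅X, Y⁆ v = differentialLinear h𝔤 hρ X (differentialLinear h𝔤 hρ Y v) -
      differentialLinear h𝔤 hρ Y (differentialLinear h𝔤 hρ X v) := by
  refine eq_of_forall_dual fun φ => ?_
  let γ : ℂ → 𝔤 := fun t =>
    ⟨_, conj_exp_mem h𝔤 (expElt h𝔤 (t • X)) Y⟩
  have hinv (t : ℂ) : (expElt h𝔤 (t • X))⁻¹ = expElt h𝔤 ((-t) • X) := by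
    rw [inv_eq_iff_mul_eq_one, ← expElt_add_smul, add_neg_cancel, zero_smul, expElt_zero]
  have hγ (t : ℂ) : (γ t : Matrix (Fin n) (Fin n) ℂ) =
      NormedSpace.exp (t • (X : Matrix (Fin n) (Fin n) ℂ)) * Y *
        NormedSpace.exp ((-t) • (X : Matrix (Fin n) (Fin n) ℂ)) := by
    change (expElt h𝔤 (t • X)).val.val * Y * ((expElt h𝔤 (t • X))⁻¹).val.val = _
    rw [hinv, coe_expElt_smul, coe_expElt_smul]
  have h1 (t : ℂ) : φ (differentialLinear h𝔤 hρ (γ t) (ρ (expElt h𝔤 (t • X)) v)) =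
      φ (ρ (expElt h𝔤 (t • X)) (differentialLinear h𝔤 hρ Y v)) :=
    congrArg φ (differential_conj h𝔤 hρ _ Y (γ t) rfl v)
  have h2 := hasDerivAt_zero h𝔤 hρ X φ (differentialLinear h𝔤 hρ Y v)
  choose D hD using fun i => exists_fderiv h𝔤 hρ φ (finBasis ℂ V i)
  have hM : HasDerivAt (fun t : ℂ => (γ t : Matrix (Fin n) (Fin n) ℂ))
      (⁅X, Y⁆ : 𝔤).val 0 := by
    have e1 := hasDerivAt_matrix_exp (X : Matrix (Fin n) (Fin n) ℂ) 0
    have e2 : HasDerivAt (fun t : ℂ => NormedSpace.exp ((-t) • (X : Matrix (Fin n) (Fin n) ℂ)))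
        (-(X : Matrix (Fin n) (Fin n) ℂ)) 0 := by
      have e3 := hasDerivAt_matrix_exp (-(X : Matrix (Fin n) (Fin n) ℂ)) 0
      simp only [smul_neg, ← neg_smul] at e3
      simpa using e3
    have e4 := (e1.mul_const (Y : Matrix (Fin n) (Fin n) ℂ)).mul e2
    have hfun : (fun t : ℂ => (γ t : Matrix (Fin n) (Fin n) ℂ)) =
      (fun t : ℂ => NormedSpace.exp (t • (X : Matrix (Fin n) (Fin n) ℂ)) * Y) *
        fun t : ℂ => NormedSpace.exp ((-t) • (X : Matrix (Fin n) (Fin n) ℂ)) := funext hγ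
    rw [hfun]
    refine e4.congr_deriv ?_
    have : (⁅X, Y⁆ : 𝔤).val = X.val * Y.val - Y.val * X.val := by
      rw [LieSubalgebra.coe_bracket, Ring.lie_def]
    rw [this]
    simp [sub_eq_add_neg]
  have h3 : HasDerivAt
      (fun t : ℂ => φ (differentialLinear h𝔤 hρ (γ t) (ρ (expElt h𝔤 (t • X)) v)))
      (φ (differentialLinear h𝔤 hρ Y (differentialLinear h𝔤 hρ X v)) +
        φ (differentialLinear h𝔤 hρ ⁅X, Y⁆ v)) 0 := by
    have hc (i) := hasDerivAt_zero h𝔤 hρ X ((finBasis ℂ V).coord i) v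
    have hd (i) := (D i).hasFDerivAt.comp_hasDerivAt (0 : ℂ) hM
    have hγ0 : γ 0 = Y := Subtype.ext (by rw [hγ]; simp)
    have expand (Z : 𝔤) (w : V) : φ (differentialLinear h𝔤 hρ Z w) =
        ∑ i, (finBasis ℂ V).coord i w * D i Z := by
      conv_lhs => rw [← (finBasis ℂ V).sum_repr w]
      simp only [map_sum, map_smul, smul_eq_mul, ← hD]
      rfl
    refine hasDerivAt_of_eq
      (HasDerivAt.fun_sum (u := Finset.univ) fun i _ => (hc i).mul (hd i)) (fun t => ?_) ?_
    · rw [expand]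
      rfl
    · rw [expand, expand, ← Finset.sum_add_distrib]
      refine Finset.sum_congr rfl fun i _ => ?_
      simp only [Function.comp_apply, zero_smul, expElt_zero, map_one, Module.End.one_apply, hγ0]
      rfl
  have h4 := h3.unique (hasDerivAt_of_eq h2 h1 rfl)
  rw [map_sub]
  exact eq_sub_of_add_eq' h4

/-- The differential of a rational representation. -/
noncomputable def differential : 𝔤 →ₗ⁅ℂ⁆ End ℂ V :=
  { differentialLinear h𝔤 hρ with
    map_lie' := fun {X Y} => LinearMap.ext fun v => differential_lie h𝔤 hρ X Y v }

/-- Matrix coefficients along one-parameter subgroups as exponential series. -/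
lemma hasSum_expElt (X : 𝔤) (φ : Dual ℂ V) (v : V) (t : ℂ) :
    HasSum (fun k : ℕ => (k.factorial : ℂ)⁻¹ • t ^ k • φ ((differential h𝔤 hρ X ^ k) v))
      (φ (ρ (expElt h𝔤 (t • X)) v)) := by
  have hderiv (w : V) : deriv (fun t : ℂ => φ (ρ (expElt h𝔤 (t • X)) w)) =
      fun t : ℂ => φ (ρ (expElt h𝔤 (t • X)) (differential h𝔤 hρ X w)) :=
    funext fun s => (hasDerivAt_orbit h𝔤 hρ X φ w s).deriv
  have hiter (k : ℕ) : iteratedDeriv k (fun t : ℂ => φ (ρ (expElt h𝔤 (t • X)) v)) =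
      fun t : ℂ => φ (ρ (expElt h𝔤 (t • X)) ((differential h𝔤 hρ X ^ k) v)) := by
    induction k with
    | zero => simp
    | succ k ih => rw [iteratedDeriv_succ, ih, hderiv, pow_succ', Module.End.mul_apply]
  have h := Complex.hasSum_taylorSeries_of_entire
    (f := fun t : ℂ => φ (ρ (expElt h𝔤 (t • X)) v))
    (fun s => (hasDerivAt_orbit h𝔤 hρ X φ v s).differentiableAt) 0 t
  simpa [hiter, expElt_zero] using h

end Differential
end Branching

namespace Branching

open Module LieAlgebra

/-! ### Connected closed subgroups are generated by exponentials -/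

section ClosedSubgroup

open scoped Matrix.Norms.Operator Topology
open Filter

variable {n : ℕ}

/-- The exponential of a matrix as an element of the general linear group. -/
noncomputable def expGL (A : Matrix (Fin n) (Fin n) ℂ) : GL (Fin n) ℂ := (Matrix.isUnit_exp A).unit

lemma coe_expGL (A : Matrix (Fin n) (Fin n) ℂ) : (expGL A).val = NormedSpace.exp A := rfl

lemma differentiable_eval_entries (p : MvPolynomial (Fin n × Fin n) ℂ) :
    Differentiable ℂ
      (fun A : Matrix (Fin n) (Fin n) ℂ => MvPolynomial.eval (fun ij => A ij.1 ij.2) p) := by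
  induction p using MvPolynomial.induction_on with
  | C a => simp
  | add p q hp hq =>
    simp only [map_add]
    exact hp.add hq
  | mul_X p ij hp =>
    simp only [map_mul, MvPolynomial.eval_X]
    exact hp.mul (differentiable_entry ij.1 ij.2)

lemma eq_zero_of_forall_real {f : ℂ → ℂ} (hf : Differentiable ℂ f) (h : ∀ t : ℝ, f t = 0) (z : ℂ) :
    f z = 0 := by
  have ha : AnalyticOnNhd ℂ f Set.univ := fun z _ => hf.analyticAt z
  refine ha.eqOn_zero_of_preconnected_of_frequently_eq_zero isPreconnected_univ
    (Set.mem_univ (0 : ℂ)) ?_ (Set.mem_univ z)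
  have ht : Tendsto (fun k : ℕ => ((1 / ((k : ℝ) + 1) : ℝ) : ℂ)) atTop (𝓝[≠] 0) := by
    refine tendsto_nhdsWithin_of_tendsto_nhds_of_eventually_within _ ?_ (Eventually.of_forall ?_)
    · have := (Complex.continuous_ofReal.tendsto 0).comp
        (tendsto_one_div_add_atTop_nhds_zero_nat (𝕜 := ℝ))
      simp only [Function.comp_def, Complex.ofReal_zero] at this
      exact this
    · intro k
      have : (1 / ((k : ℝ) + 1) : ℝ) ≠ 0 := by positivity
      exact Complex.ofReal_ne_zero.mpr this
  exact ht.frequently (Eventually.of_forall fun k => h _).frequently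

variable {G : Subgroup (GL (Fin n) ℂ)} {𝔤 : LieSubalgebra ℂ (Matrix (Fin n) (Fin n) ℂ)}

/-- The defining polynomials are holomorphic in `t` along `exp (t X)`, so vanishing for real `t`
forces vanishing for complex `t`. -/
lemma mem_lieAlgebra_of_real (hG : IsZariskiClosed G) (h𝔤 : IsLieAlgebraOf 𝔤 G)
    {X : Matrix (Fin n) (Fin n) ℂ} (h : ∀ t : ℝ, expGL ((t : ℂ) • X) ∈ G) : X ∈ 𝔤 := by
  obtain ⟨I, hI⟩ := hG
  rw [h𝔤]
  refine fun t => ⟨expGL (t • X), (hI _).mpr fun p hp => ?_, rfl⟩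
  have h1 : Differentiable ℂ (fun t : ℂ => NormedSpace.exp (t • X)) :=
    fun t => (hasDerivAt_matrix_exp X t).differentiableAt
  have h2 := (differentiable_eval_entries p).comp h1
  exact eq_zero_of_forall_real h2 (fun t => (hI _).mp (h t) p hp) t

lemma expGL_mem_of_tendsto (hG : IsZariskiClosed G) {A : ℕ → Matrix (Fin n) (Fin n) ℂ}
    {B : Matrix (Fin n) (Fin n) ℂ} (hA : ∀ k, expGL (A k) ∈ G) (h : Tendsto A atTop (𝓝 B)) :
    expGL B ∈ G := by
  obtain ⟨I, hI⟩ := hG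
  refine (hI _).mpr fun p hp => ?_
  have hc : Continuous fun A : Matrix (Fin n) (Fin n) ℂ =>
      MvPolynomial.eval (fun ij => (NormedSpace.exp A) ij.1 ij.2) p :=
    (differentiable_eval_entries p).continuous.comp NormedSpace.exp_continuous
  refine tendsto_nhds_unique ((hc.tendsto B).comp h) ?_
  have : (fun k => MvPolynomial.eval (fun ij => (NormedSpace.exp (A k)) ij.1 ij.2) p) =
      fun _ => 0 := funext fun k => (hI _).mp (hA k) p hp
  simp only [Function.comp_def, this]
  exact tendsto_const_nhds

lemma expGL_zsmul (A : Matrix (Fin n) (Fin n) ℂ) (m : ℤ) : expGL (m • A) = expGL A ^ m :=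
  Units.ext (by rw [Matrix.coe_units_zpow, coe_expGL, coe_expGL, Matrix.exp_zsmul])

/-- Limit directions of a closed subgroup belong to its Lie algebra. -/
lemma limit_direction_mem (hG : IsZariskiClosed G) (h𝔤 : IsLieAlgebraOf 𝔤 G)
    {Y : ℕ → Matrix (Fin n) (Fin n) ℂ} {Z : Matrix (Fin n) (Fin n) ℂ} (hY : ∀ k, expGL (Y k) ∈ G)
    (hY0 : ∀ k, Y k ≠ 0) (hlim : Tendsto Y atTop (𝓝 0))
    (hdir : Tendsto (fun k => ((‖Y k‖⁻¹ : ℝ) : ℂ) • Y k) atTop (𝓝 Z)) : Z ∈ 𝔤 := by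
  refine mem_lieAlgebra_of_real hG h𝔤 fun t => ?_
  -- The integer multiple `N k • Y k` approximates `t • Z`: rounding costs at most `‖Y k‖`, which
  -- tends to zero, while its exponential is a power of an element of `G`.
  let N : ℕ → ℤ := fun k => ⌊t / ‖Y k‖⌋
  refine expGL_mem_of_tendsto hG (A := fun k => N k • Y k) (fun k => ?_) ?_
  · rw [expGL_zsmul]
    exact zpow_mem (hY k) _
  have hnorm : Tendsto (fun k => ‖Y k‖) atTop (𝓝 0) := by simpa using hlim.norm
  have hN : Tendsto (fun k => (N k : ℝ) * ‖Y k‖) atTop (𝓝 t) := by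
    rw [tendsto_iff_dist_tendsto_zero]
    refine squeeze_zero (fun _ => dist_nonneg) (fun k => ?_) hnorm
    have hpos : 0 < ‖Y k‖ := norm_pos_iff.mpr (hY0 k)
    have h1 : (N k : ℝ) ≤ t / ‖Y k‖ := Int.floor_le _
    have h2 : t / ‖Y k‖ < N k + 1 := Int.lt_floor_add_one _
    rw [le_div_iff₀ hpos] at h1
    rw [div_lt_iff₀ hpos] at h2
    rw [Real.dist_eq, abs_le]
    constructor <;> linarith
  have h3 := ((Complex.continuous_ofReal.tendsto t).comp hN).smul hdir
  refine h3.congr fun k => ?_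
  have hpos : (‖Y k‖ : ℂ) ≠ 0 := by
    rw [Complex.ofReal_ne_zero]
    exact norm_ne_zero_iff.mpr (hY0 k)
  rw [Function.comp_apply, smul_smul, ← Int.cast_smul_eq_zsmul ℂ]
  congr 1
  push_cast
  field_simp

/-- Otherwise there are nonzero `Y k → 0` in `M` with exponentials in `G`. By compactness of the
unit sphere their directions accumulate at a unit vector lying in both `𝔤` and `M`. -/
lemma eventually_transversal (hG : IsZariskiClosed G) (h𝔤 : IsLieAlgebraOf 𝔤 G)
    {M : Submodule ℂ (Matrix (Fin n) (Fin n) ℂ)} (hM : Disjoint 𝔤.toSubmodule M) :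
    ∀ᶠ Y in 𝓝 (0 : Matrix (Fin n) (Fin n) ℂ), Y ∈ M → expGL Y ∈ G → Y = 0 := by
  have : FirstCountableTopology (Matrix (Fin n) (Fin n) ℂ) :=
    inferInstanceAs (FirstCountableTopology (Fin n → Fin n → ℂ))
  by_contra hcon
  rw [not_eventually] at hcon
  obtain ⟨Y, hlim, hY⟩ := exists_seq_forall_of_frequently hcon
  simp only [Classical.not_imp] at hY
  let Z : ℕ → Matrix (Fin n) (Fin n) ℂ := fun k => ((‖Y k‖⁻¹ : ℝ) : ℂ) • Y k
  have hZ (k) : Z k ∈ Metric.sphere (0 : Matrix (Fin n) (Fin n) ℂ) 1 := by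
    have : ‖Y k‖ ≠ 0 := norm_ne_zero_iff.mpr (hY k).2.2
    rw [mem_sphere_zero_iff_norm]
    simp [Z, norm_smul, this]
  obtain ⟨W, hW, φ, hφ, hlimW⟩ := (isCompact_sphere (0 : Matrix (Fin n) (Fin n) ℂ) 1).tendsto_subseq hZ
  have h1 : W ∈ 𝔤 := limit_direction_mem hG h𝔤 (Y := Y ∘ φ) (fun k => (hY _).2.1)
    (fun k => (hY _).2.2) (hlim.comp hφ.tendsto_atTop) hlimW
  have h2 : W ∈ M := M.closed_of_finiteDimensional.mem_of_tendsto hlimW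
    (Eventually.of_forall fun k => M.smul_mem _ (hY _).1)
  have h3 : W = 0 := Submodule.disjoint_def.mp hM W h1 h2
  rw [h3] at hW
  simp at hW

/-- With projections `P` onto `𝔤` and `Q` onto a complement, `A ↦ exp (P A) exp (Q A)` has
derivative `P + Q = 1` at zero, so its values fill a neighbourhood of `1`. If such a product lies in
`G`, so does `exp (Q A)`, and transversality gives `Q A = 0`. -/
lemma eventually_mem_exp (hG : IsZariskiClosed G) (h𝔤 : IsLieAlgebraOf 𝔤 G) :
    ∀ᶠ B in 𝓝 (1 : Matrix (Fin n) (Fin n) ℂ), ∀ g ∈ G, g.val = B →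
      ∃ X : 𝔤, B = NormedSpace.exp (X : Matrix (Fin n) (Fin n) ℂ) := by
  obtain ⟨M, hM⟩ := 𝔤.toSubmodule.exists_isCompl
  let P : Matrix (Fin n) (Fin n) ℂ →L[ℂ] Matrix (Fin n) (Fin n) ℂ :=
    LinearMap.toContinuousLinearMap (𝔤.toSubmodule.subtype ∘ₗ 𝔤.toSubmodule.projectionOnto M hM)
  let Q : Matrix (Fin n) (Fin n) ℂ →L[ℂ] Matrix (Fin n) (Fin n) ℂ := ContinuousLinearMap.id ℂ _ - P
  have hP (A) : P A ∈ 𝔤 := SetLike.coe_mem (𝔤.toSubmodule.projectionOnto M hM A)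
  have hQ (A) : Q A ∈ M := by
    rw [← Submodule.ker_projectionOnto hM, LinearMap.mem_ker]
    change 𝔤.toSubmodule.projectionOnto M hM (A - 𝔤.toSubmodule.projectionOnto M hM A) = 0
    rw [map_sub, Submodule.projectionOnto_apply_left, sub_self]
  let Φ : Matrix (Fin n) (Fin n) ℂ → Matrix (Fin n) (Fin n) ℂ :=
    fun A => NormedSpace.exp (P A) * NormedSpace.exp (Q A)
  have hexp : HasStrictFDerivAt (NormedSpace.exp : Matrix (Fin n) (Fin n) ℂ → _)
      (1 : Matrix (Fin n) (Fin n) ℂ →L[ℂ] Matrix (Fin n) (Fin n) ℂ) 0 :=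
    hasStrictFDerivAt_exp_zero
  have hΦ : HasStrictFDerivAt Φ
      (ContinuousLinearEquiv.refl ℂ (Matrix (Fin n) (Fin n) ℂ) : _ →L[ℂ] _) 0 := by
    have e1 : HasStrictFDerivAt (fun A => NormedSpace.exp (P A)) P 0 := by
      have : HasStrictFDerivAt (NormedSpace.exp : Matrix (Fin n) (Fin n) ℂ → _)
        (1 : Matrix (Fin n) (Fin n) ℂ →L[ℂ] Matrix (Fin n) (Fin n) ℂ) (P 0) := by rwa [map_zero]
      exact this.comp 0 P.hasStrictFDerivAt
    have e2 : HasStrictFDerivAt (fun A => NormedSpace.exp (Q A)) Q 0 := by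
      have : HasStrictFDerivAt (NormedSpace.exp : Matrix (Fin n) (Fin n) ℂ → _)
        (1 : Matrix (Fin n) (Fin n) ℂ →L[ℂ] Matrix (Fin n) (Fin n) ℂ) (Q 0) := by rwa [map_zero]
      exact this.comp 0 Q.hasStrictFDerivAt
    have e3 := e1.mul' e2
    refine e3.congr_fderiv ?_
    ext1 A
    change NormedSpace.exp (P 0) * Q A + P A * NormedSpace.exp (Q 0) = A
    simp [Q]
  have hmap : map Φ (𝓝 (0 : Matrix (Fin n) (Fin n) ℂ)) = 𝓝 (1 : Matrix (Fin n) (Fin n) ℂ) := by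
    have h := hΦ.map_nhds_eq_of_equiv
    rw [show Φ 0 = 1 by simp [Φ]] at h
    exact h
  rw [← hmap, eventually_map]
  have hev : ∀ᶠ A in 𝓝 (0 : Matrix (Fin n) (Fin n) ℂ), Q A ∈ M → expGL (Q A) ∈ G → Q A = 0 := by
    have hQ0 : Tendsto Q (𝓝 0) (𝓝 0) := by simpa using Q.continuous.tendsto 0
    exact hQ0.eventually (eventually_transversal hG h𝔤 hM.disjoint)
  filter_upwards [hev] with A hA g hg hgA
  have h1 : expGL (Q A) = (expElt h𝔤 ⟨P A, hP A⟩).val⁻¹ * g := by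
    rw [eq_inv_mul_iff_mul_eq]
    refine Units.ext ?_
    rw [Units.val_mul, coe_expElt, hgA, coe_expGL]
  have h2 := hA (hQ A) (h1 ▸ mul_mem (inv_mem (SetLike.coe_mem _)) hg)
  refine ⟨⟨P A, hP A⟩, ?_⟩
  simp [Φ, h2]

/-- A connected Zariski closed subgroup is generated by the exponentials of its Lie algebra. -/
theorem closure_range_expElt [ConnectedSpace G] (hG : IsZariskiClosed G)
    (h𝔤 : IsLieAlgebraOf 𝔤 G) : Subgroup.closure (Set.range (expElt h𝔤)) = ⊤ := by
  have h1 : (Subgroup.closure (Set.range (expElt h𝔤)) : Set G) ∈ 𝓝 (1 : G) := by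
    have hc : Continuous fun g : G => g.val.val := Units.continuous_val.comp continuous_subtype_val
    have ht := hc.tendsto 1
    filter_upwards [ht.eventually (eventually_mem_exp hG h𝔤)] with g hg
    obtain ⟨X, hX⟩ := hg g.val g.2 rfl
    rw [eq_expElt h𝔤 hX]
    exact Subgroup.subset_closure ⟨X, rfl⟩
  have hopen := Subgroup.isOpen_of_mem_nhds _ h1
  have hclopen : IsClopen (Subgroup.closure (Set.range (expElt h𝔤)) : Set G) :=
    ⟨Subgroup.isClosed_of_isOpen _ hopen, hopen⟩
  have := hclopen.eq_univ ⟨1, one_mem _⟩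
  exact SetLike.coe_injective this

end ClosedSubgroup
end Branching

namespace Branching

open Module LieAlgebra

/-! ### Transfer between the group and its Lie algebra -/

section Bridge

variable {n : ℕ} {G : Subgroup (GL (Fin n) ℂ)} {𝔤 : LieSubalgebra ℂ (Matrix (Fin n) (Fin n) ℂ)}
  (h𝔤 : IsLieAlgebraOf 𝔤 G) {V : Type*} [AddCommGroup V] [Module ℂ V] [FiniteDimensional ℂ V]
  {ρ : Representation ℂ G V} (hρ : IsRational ρ)

lemma apply_expElt_of_eigen {X : 𝔤} {φ : Dual ℂ V} {v : V} {c : ℂ}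
    (h : ∀ k : ℕ, φ ((differential h𝔤 hρ X ^ k) v) = c ^ k * φ v) (t : ℂ) :
    φ (ρ (expElt h𝔤 (t • X)) v) = Complex.exp (t * c) * φ v := by
  refine (hasSum_expElt h𝔤 hρ X φ v t).unique ?_
  have h1 := (NormedSpace.exp_series_hasSum_exp' (𝕂 := ℂ) (t * c)).mul_right (φ v)
  rw [← Complex.exp_eq_exp_ℂ] at h1
  have h2 : (fun k : ℕ => (k.factorial : ℂ)⁻¹ • t ^ k • φ ((differential h𝔤 hρ X ^ k) v)) =
      fun k : ℕ => (k.factorial : ℂ)⁻¹ • (t * c) ^ k * φ v := funext fun k => by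
    rw [h]
    simp only [smul_eq_mul, mul_pow]
    ring
  rw [h2]
  exact h1

lemma expElt_eigenvector_iff (X : 𝔤) (v : V) (c : ℂ) :
    differential h𝔤 hρ X v = c • v ↔ ∀ t : ℂ, ρ (expElt h𝔤 (t • X)) v = Complex.exp (t * c) • v := by
  constructor
  · intro h t
    refine eq_of_forall_dual fun φ => ?_
    rw [map_smul, smul_eq_mul]
    refine apply_expElt_of_eigen h𝔤 hρ (fun k => ?_) t
    have : (differential h𝔤 hρ X ^ k) v = c ^ k • v := by
      induction k with
      | zero => simp
      | succ k ih => rw [pow_succ', Module.End.mul_apply, ih, map_smul, h, smul_smul, pow_succ]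
    rw [this, map_smul, smul_eq_mul]
  · intro h
    refine eq_of_forall_dual fun φ => ?_
    refine (hasDerivAt_zero h𝔤 hρ X φ v).unique ?_
    have h1 : HasDerivAt (fun t : ℂ => Complex.exp (t * c) * φ v) (c * φ v) 0 := by
      have := (((hasDerivAt_id (0 : ℂ)).mul_const c).cexp).mul_const (φ v)
      simpa using this
    exact hasDerivAt_of_eq h1 (fun t => by rw [h, map_smul, smul_eq_mul]) (by simp)

lemma expElt_eigencovector_iff (X : 𝔤) (φ : Dual ℂ V) (c : ℂ) :
    (∀ w, φ (differential h𝔤 hρ X w) = c * φ w) ↔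
      ∀ (t : ℂ) (w : V), φ (ρ (expElt h𝔤 (t • X)) w) = Complex.exp (t * c) * φ w := by
  constructor
  · intro h t w
    refine apply_expElt_of_eigen h𝔤 hρ (fun k => ?_) t
    induction k with
    | zero => simp
    | succ k ih => rw [pow_succ', Module.End.mul_apply, h, ih, pow_succ']; ring
  · intro h w
    refine (hasDerivAt_zero h𝔤 hρ X φ w).unique ?_
    have h1 : HasDerivAt (fun t : ℂ => Complex.exp (t * c) * φ w) (c * φ w) 0 := by
      have := (((hasDerivAt_id (0 : ℂ)).mul_const c).cexp).mul_const (φ w)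
      simpa using this
    exact hasDerivAt_of_eq h1 (fun t => by rw [h]) rfl

-- Inverses of exponentials are exponentials, so induction over left multiplication by exponentials
-- suffices.
include h𝔤 in
lemma forall_of_closure (hgen : Subgroup.closure (Set.range (expElt h𝔤)) = ⊤) {p : G → Prop}
    (h1 : p 1) (hmul : ∀ X g, p g → p (expElt h𝔤 X * g)) (g : G) : p g := by
  have hinv (X : 𝔤) : (expElt h𝔤 X)⁻¹ = expElt h𝔤 (-X) := by
    rw [inv_eq_iff_mul_eq_one]
    have := expElt_add_smul h𝔤 1 (-1) X
    rwa [add_neg_cancel, zero_smul, expElt_zero, one_smul, neg_one_smul, eq_comm] at this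
  have hg : g ∈ Subgroup.closure (Set.range (expElt h𝔤)) := by rw [hgen]; trivial
  induction hg using Subgroup.closure_induction_left with
  | one => exact h1
  | mul_left x hx y _ ih => obtain ⟨X, rfl⟩ := hx; exact hmul X y ih
  | inv_mul_cancel x hx y _ ih => obtain ⟨X, rfl⟩ := hx; rw [hinv]; exact hmul _ y ih

lemma differential_mem {W : Submodule ℂ V} (hW : ∀ g, ∀ w ∈ W, ρ g w ∈ W) (X : 𝔤) {w : V}
    (hw : w ∈ W) : differential h𝔤 hρ X w ∈ W := by
  rw [← Subspace.forall_mem_dualAnnihilator_apply_eq_zero_iff]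
  intro φ hφ
  rw [Submodule.mem_dualAnnihilator] at hφ
  refine (hasDerivAt_zero h𝔤 hρ X φ w).unique ?_
  exact hasDerivAt_of_eq (hasDerivAt_const 0 (0 : ℂ)) (fun t => hφ _ (hW _ w hw)) rfl

/-- Every functional annihilating `W` kills each term of the exponential series, hence its sum. -/
lemma apply_mem_of_differential_mem (hgen : Subgroup.closure (Set.range (expElt h𝔤)) = ⊤)
    {W : Submodule ℂ V} (hW : ∀ X, ∀ w ∈ W, differential h𝔤 hρ X w ∈ W) (g : G) :
    ∀ w ∈ W, ρ g w ∈ W := by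
  refine forall_of_closure h𝔤 hgen (p := fun g => ∀ w ∈ W, ρ g w ∈ W) (by simp) ?_ g
  intro X g hg w hw
  rw [map_mul, Module.End.mul_apply, ← Subspace.forall_mem_dualAnnihilator_apply_eq_zero_iff]
  intro φ hφ
  rw [Submodule.mem_dualAnnihilator] at hφ
  have hk (k : ℕ) : (differential h𝔤 hρ X ^ k) (ρ g w) ∈ W := by
    induction k with
    | zero => simpa using hg w hw
    | succ k ih => rw [pow_succ', Module.End.mul_apply]; exact hW X _ ih
  have h := hasSum_expElt h𝔤 hρ X φ (ρ g w) 1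
  simp only [hφ _ (hk _), smul_zero, one_smul] at h
  exact h.unique hasSum_zero

variable {V' : Type*} [AddCommGroup V'] [Module ℂ V'] [FiniteDimensional ℂ V']
  {ρ' : Representation ℂ G V'} (hρ' : IsRational ρ')

lemma equivariant_of_differential (hgen : Subgroup.closure (Set.range (expElt h𝔤)) = ⊤)
    {f : V →ₗ[ℂ] V'}
    (hf : ∀ X v, f (differential h𝔤 hρ X v) = differential h𝔤 hρ' X (f v)) (g : G) :
    ∀ v, f (ρ g v) = ρ' g (f v) := by
  refine forall_of_closure h𝔤 hgen (p := fun g => ∀ v, f (ρ g v) = ρ' g (f v)) (by simp) ?_ g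
  intro X g hg v
  rw [map_mul, Module.End.mul_apply, map_mul, Module.End.mul_apply, ← hg]
  refine eq_of_forall_dual fun φ => ?_
  have hk (k : ℕ) (w : V) : f ((differential h𝔤 hρ X ^ k) w) =
      (differential h𝔤 hρ' X ^ k) (f w) := by
    induction k with
    | zero => simp
    | succ k ih => rw [pow_succ', Module.End.mul_apply, hf, ih, pow_succ', Module.End.mul_apply]
  have h1 := hasSum_expElt h𝔤 hρ X (φ ∘ₗ f) (ρ g v) 1
  have h2 := hasSum_expElt h𝔤 hρ' X φ (f (ρ g v)) 1
  simp only [LinearMap.comp_apply, hk, one_smul] at h1 h2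
  exact h1.unique h2

/-- The Lie module structure obtained by differentiating a rational representation. -/
@[reducible] noncomputable def diffLieRingModule : LieRingModule 𝔤 V where
  bracket X v := differential h𝔤 hρ X v
  add_lie X Y v := by simp
  lie_add X v w := by simp
  leibniz_lie X Y v := by
    rw [LieHom.map_lie, LieRing.of_associative_ring_bracket]
    simp

lemma diffLieModule : letI := diffLieRingModule h𝔤 hρ; LieModule ℂ 𝔤 V :=
  letI := diffLieRingModule h𝔤 hρ
  { smul_lie := fun t X v => by
      change differential h𝔤 hρ (t • X) v = t • differential h𝔤 hρ X v
      simp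
    lie_smul := fun t X v => by
      change differential h𝔤 hρ X (t • v) = t • differential h𝔤 hρ X v
      simp }

lemma isIrreducible_differential (hgen : Subgroup.closure (Set.range (expElt h𝔤)) = ⊤)
    (hirr : ρ.IsIrreducible) : letI := diffLieRingModule h𝔤 hρ; LieModule.IsIrreducible ℂ 𝔤 V := by
  let := diffLieRingModule h𝔤 hρ
  have hnt : (⊥ : Subrepresentation ρ) ≠ ⊤ := bot_ne_top
  have hall (W : Submodule ℂ V) (hW : ∀ X : 𝔤, ∀ w ∈ W, differential h𝔤 hρ X w ∈ W) :
      W = ⊥ ∨ W = ⊤ := by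
    rcases eq_bot_or_eq_top (⟨W, fun g v hv =>
      apply_mem_of_differential_mem h𝔤 hρ hgen hW g v hv⟩ : Subrepresentation ρ) with h | h
    · exact Or.inl (congrArg Subrepresentation.toSubmodule h)
    · exact Or.inr (congrArg Subrepresentation.toSubmodule h)
  have : Nontrivial V := by
    by_contra hV
    rw [not_nontrivial_iff_subsingleton] at hV
    exact hnt (Subrepresentation.toSubmodule_injective (Subsingleton.elim _ _))
  refine LieModule.IsIrreducible.mk fun N hN => ?_
  rw [← LieSubmodule.toSubmodule_eq_top]
  refine (hall N.toSubmodule fun X w hw => N.lie_mem hw).resolve_left fun h => hN ?_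
  rwa [← LieSubmodule.toSubmodule_eq_bot]

variable [LieAlgebra.IsSimple ℂ 𝔤] {H : LieSubalgebra ℂ 𝔤} [H.IsCartanSubalgebra]
  (b : (IsKilling.rootSystem H).Base)

lemma isHighestWeightVector_iff (l : Dual ℂ H) (v : V) :
    letI := diffLieRingModule h𝔤 hρ
    IsHighestWeightVector b ρ l v ↔ IsHighestWeightVec b l v := by
  let := diffLieRingModule h𝔤 hρ
  constructor
  · rintro ⟨h0, hH, hN⟩
    refine ⟨h0, fun h => ?_, fun X hX => ?_⟩
    · refine (expElt_eigenvector_iff h𝔤 hρ (h : 𝔤) v (l h)).mpr fun t => ?_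
      have := hH (t • h) _ (coe_expElt h𝔤 _)
      rwa [map_smul, smul_eq_mul] at this
    · rw [← zero_smul ℂ v]
      refine (expElt_eigenvector_iff h𝔤 hρ X v 0).mpr fun t => ?_
      rw [hN (t • X) (Submodule.smul_mem _ t hX) _ (coe_expElt h𝔤 _), mul_zero, Complex.exp_zero,
        one_smul]
  · rintro ⟨h0, hH, hN⟩
    refine ⟨h0, fun h g hg => ?_, fun X hX g hg => ?_⟩
    · rw [eq_expElt h𝔤 hg]
      simpa using (expElt_eigenvector_iff h𝔤 hρ (h : 𝔤) v (l h)).mp (hH h) 1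
    · rw [eq_expElt h𝔤 hg]
      simpa using (expElt_eigenvector_iff h𝔤 hρ X v 0).mp ((hN X hX).trans (zero_smul ℂ v).symm) 1

lemma isLowestWeightCovec_iff (l : Dual ℂ H) (η : Dual ℂ V) :
    letI := diffLieRingModule h𝔤 hρ
    IsLowestWeightCovec b l η ↔
      (∀ (h : H) (w : V), η (ρ (expElt h𝔤 (h : 𝔤)) w) = Complex.exp (l h) * η w) ∧
      (∀ X ∈ oppositeNilradical b, ∀ w : V, η (ρ (expElt h𝔤 X) w) = η w) := by
  let := diffLieRingModule h𝔤 hρ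
  constructor
  · rintro ⟨hH, hN⟩
    refine ⟨fun h w => ?_, fun X hX w => ?_⟩
    · simpa using (expElt_eigencovector_iff h𝔤 hρ (h : 𝔤) η (l h)).mp (hH h) 1 w
    · simpa using (expElt_eigencovector_iff h𝔤 hρ X η 0).mp
        (fun w => (hN X hX w).trans (zero_mul _).symm) 1 w
  · rintro ⟨hH, hN⟩
    refine ⟨fun h => ?_, fun X hX w => ?_⟩
    · refine (expElt_eigencovector_iff h𝔤 hρ (h : 𝔤) η (l h)).mpr fun t w => ?_
      have := hH (t • h) w
      rwa [map_smul, smul_eq_mul] at this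
    · have := (expElt_eigencovector_iff h𝔤 hρ X η 0).mpr fun t w => by
        rw [hN (t • X) (Submodule.smul_mem _ t hX) w, mul_zero, Complex.exp_zero, one_mul]
      rw [← zero_mul (η w)]
      exact this w

end Bridge
end Branching

namespace Branching

open Module LieAlgebra

/-! ### Regular functions on the group -/

section RegularFunctions

variable {n : ℕ} (G : Subgroup (GL (Fin n) ℂ))

/-- The matrix entries and the inverse of the determinant as functions on `G`. -/
noncomputable def coordFun (o : Option (Fin n × Fin n)) (g : G) : ℂ :=
  o.elim (g.val.val.det)⁻¹ (fun ij => g.val.val ij.1 ij.2)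

/-- The algebra of regular functions on `G`. -/
noncomputable def regularAlgebra : Subalgebra ℂ (G → ℂ) :=
  Algebra.adjoin ℂ (Set.range (coordFun G))

variable {G}

lemma mem_regularAlgebra_iff {f : G → ℂ} : f ∈ regularAlgebra G ↔ IsRegular G f := by
  have h (p : MvPolynomial (Option (Fin n × Fin n)) ℂ) (g : G) :
      MvPolynomial.aeval (coordFun G) p g = MvPolynomial.eval (fun o => coordFun G o g) p := by
    induction p using MvPolynomial.induction_on with
    | C a => simp
    | add p q hp hq => simp [hp, hq]
    | mul_X p o hp => simp [hp]
  rw [regularAlgebra, Algebra.adjoin_range_eq_range_aeval, AlgHom.mem_range]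
  exact exists_congr fun p => ⟨fun hp g => by rw [← hp, h]; rfl,
    fun hp => funext fun g => (h p g).trans (hp g).symm⟩

variable (G) in
/-- The representation of `G` on functions by right translation. -/
def rightTranslation : Representation ℂ G (G → ℂ) where
  toFun g := LinearMap.funLeft ℂ ℂ (fun x => x * g)
  map_one' := by ext; simp [LinearMap.funLeft]
  map_mul' g h := by ext; simp [LinearMap.funLeft, mul_assoc]

lemma rightTranslation_apply (g : G) (f : G → ℂ) (x : G) : rightTranslation G g f x = f (x * g) :=
  rfl

lemma coordFun_mul_some (i j : Fin n) (x y : G) :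
    coordFun G (some (i, j)) (x * y) = ∑ k, coordFun G (some (i, k)) x * coordFun G (some (k, j)) y := by
  simp [coordFun, Matrix.mul_apply]

lemma coordFun_mul_none (x y : G) :
    coordFun G none (x * y) = coordFun G none x * coordFun G none y := by
  simp [coordFun, mul_comm]

variable (G) in
/-- The span of the constants and the coordinate functions. -/
noncomputable def coordSpan : Submodule ℂ (G → ℂ) :=
  Submodule.span ℂ (insert 1 (Set.range (coordFun G)))

lemma one_le_coordSpan : 1 ≤ coordSpan G := by
  rw [Submodule.one_eq_span, Submodule.span_singleton_le_iff_mem]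
  exact Submodule.subset_span (Set.mem_insert _ _)

lemma coordFun_mem_coordSpan (o : Option (Fin n × Fin n)) : coordFun G o ∈ coordSpan G :=
  Submodule.subset_span (Set.mem_insert_of_mem _ ⟨o, rfl⟩)

lemma finite_coordSpan_pow (d : ℕ) : FiniteDimensional ℂ (coordSpan G ^ d : Submodule ℂ (G → ℂ)) := by
  have h : (coordSpan G).FG := Submodule.fg_span ((Set.finite_range _).insert _)
  exact Module.Finite.iff_fg.mpr (h.pow d)

lemma coordSpan_pow_le (d : ℕ) : coordSpan G ^ d ≤ Subalgebra.toSubmodule (regularAlgebra G) := by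
  intro f hf
  induction hf using Submodule.pow_induction_on_left' with
  | algebraMap r => exact (regularAlgebra G).algebraMap_mem r
  | add x y i _ _ hx hy => exact (regularAlgebra G).add_mem hx hy
  | mem_mul m hm i x _ hx =>
    refine (regularAlgebra G).mul_mem ?_ hx
    refine (Submodule.span_le (p := Subalgebra.toSubmodule (regularAlgebra G))).mpr ?_ hm
    exact Set.insert_subset (regularAlgebra G).one_mem Algebra.subset_adjoin

/-- The powers of `coordSpan G` are finite-dimensional and stable under right translation. That they
exhaust the regular functions is the local finiteness of right translation. -/
lemma exists_mem_coordSpan_pow {f : G → ℂ} (hf : IsRegular G f) : ∃ d, f ∈ coordSpan G ^ d := by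
  rw [← mem_regularAlgebra_iff] at hf
  have hmono {i j : ℕ} (hij : i ≤ j) : coordSpan G ^ i ≤ coordSpan G ^ j :=
    pow_le_pow_right₀ one_le_coordSpan hij
  induction hf using Algebra.adjoin_induction with
  | mem x hx =>
    obtain ⟨o, rfl⟩ := hx
    exact ⟨1, by rw [pow_one]; exact coordFun_mem_coordSpan o⟩
  | algebraMap r => exact ⟨0, by rw [pow_zero]; exact Submodule.algebraMap_mem r⟩
  | add x y _ _ hx hy =>
    obtain ⟨i, hi⟩ := hx
    obtain ⟨j, hj⟩ := hy
    exact ⟨max i j, add_mem (hmono (le_max_left i j) hi) (hmono (le_max_right i j) hj)⟩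
  | mul x y _ _ hx hy =>
    obtain ⟨i, hi⟩ := hx
    obtain ⟨j, hj⟩ := hy
    exact ⟨i + j, by rw [pow_add]; exact Submodule.mul_mem_mul hi hj⟩

lemma rightTranslation_mem_coordSpan (g : G) {f : G → ℂ} (hf : f ∈ coordSpan G) :
    rightTranslation G g f ∈ coordSpan G := by
  refine (Submodule.span_le (p := (coordSpan G).comap (rightTranslation G g))).mpr ?_ hf
  refine Set.insert_subset (Submodule.subset_span (Set.mem_insert _ _)) ?_
  rintro _ ⟨_ | ⟨i, j⟩, rfl⟩
  · have : rightTranslation G g (coordFun G none) = coordFun G none g • coordFun G none :=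
      funext fun x => (coordFun_mul_none x g).trans (mul_comm _ _)
    change _ ∈ coordSpan G
    rw [this]
    exact Submodule.smul_mem _ _ (coordFun_mem_coordSpan _)
  · have : rightTranslation G g (coordFun G (some (i, j))) =
        ∑ k, coordFun G (some (k, j)) g • coordFun G (some (i, k)) := funext fun x => by
      rw [rightTranslation_apply, coordFun_mul_some, Finset.sum_apply]
      exact Finset.sum_congr rfl fun k _ => mul_comm _ _
    change _ ∈ coordSpan G
    rw [this]
    exact Submodule.sum_mem _ fun k _ => Submodule.smul_mem _ _ (coordFun_mem_coordSpan _)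

lemma rightTranslation_mem_pow (g : G) (d : ℕ) {f : G → ℂ} (hf : f ∈ coordSpan G ^ d) :
    rightTranslation G g f ∈ coordSpan G ^ d := by
  induction hf using Submodule.pow_induction_on_left' with
  | algebraMap r => rw [pow_zero]; exact Submodule.algebraMap_mem r
  | add x y i _ _ hx hy => rw [map_add]; exact add_mem hx hy
  | mem_mul m hm i x _ hx =>
    rw [pow_succ']
    exact Submodule.mul_mem_mul (rightTranslation_mem_coordSpan g hm) hx

lemma IsRegular.comp_mul_right {f : G → ℂ} (hf : IsRegular G f) (g : G) :
    IsRegular G (fun x => f (x * g)) := by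
  obtain ⟨d, hd⟩ := exists_mem_coordSpan_pow hf
  exact mem_regularAlgebra_iff.mp (coordSpan_pow_le d (rightTranslation_mem_pow g d hd))

lemma IsRegular.comp_mul_left {f : G → ℂ} (hf : IsRegular G f) (g : G) :
    IsRegular G (fun x => f (g * x)) := by
  rw [← mem_regularAlgebra_iff] at hf ⊢
  induction hf using Algebra.adjoin_induction with
  | mem x hx =>
    obtain ⟨_ | ⟨i, j⟩, rfl⟩ := hx
    · have : (fun x => coordFun G none (g * x)) = coordFun G none g • coordFun G none :=
        funext fun x => coordFun_mul_none g x
      rw [this]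
      exact (regularAlgebra G).smul_mem (Algebra.subset_adjoin (Set.mem_range_self _)) _
    · have : (fun x => coordFun G (some (i, j)) (g * x)) =
          ∑ k, coordFun G (some (i, k)) g • coordFun G (some (k, j)) := funext fun x => by
        rw [coordFun_mul_some, Finset.sum_apply]
        rfl
      rw [this]
      exact Subalgebra.sum_mem _ fun k _ =>
        (regularAlgebra G).smul_mem (Algebra.subset_adjoin (Set.mem_range_self _)) _
  | algebraMap r => exact (regularAlgebra G).algebraMap_mem r
  | add x y _ _ hx hy => exact (regularAlgebra G).add_mem hx hy
  | mul x y _ _ hx hy => exact (regularAlgebra G).mul_mem hx hy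

lemma IsRegular.mul {f₁ f₂ : G → ℂ} (h₁ : IsRegular G f₁) (h₂ : IsRegular G f₂) :
    IsRegular G (f₁ * f₂) := by
  rw [← mem_regularAlgebra_iff] at *
  exact mul_mem h₁ h₂

variable {𝔤 : LieSubalgebra ℂ (Matrix (Fin n) (Fin n) ℂ)} (h𝔤 : IsLieAlgebraOf 𝔤 G)

open scoped Matrix.Norms.Operator in
lemma differentiable_regularEval_exp (p : MvPolynomial (Option (Fin n × Fin n)) ℂ)
    (X : Matrix (Fin n) (Fin n) ℂ) :
    Differentiable ℂ (fun t : ℂ => regularEval p (NormedSpace.exp (t • X))) := by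
  intro t
  have h0 : IsUnit (NormedSpace.exp (t • X)) := Matrix.isUnit_exp (t • X)
  have h1 : (NormedSpace.exp (t • X)).det ≠ 0 :=
    ((Matrix.isUnit_iff_isUnit_det (NormedSpace.exp (t • X))).mp h0).ne_zero
  have h2 := hasDerivAt_matrix_exp X t
  have h3 : HasFDerivAt (regularEval p) (fderiv ℂ (regularEval p) (NormedSpace.exp (t • X)))
      (NormedSpace.exp (t • X)) := (differentiableAt_regularEval p h1).hasFDerivAt
  exact (h3.comp_hasDerivAt_of_eq t h2 rfl).differentiableAt

lemma IsRegular.differentiable_expElt {f : G → ℂ} (hf : IsRegular G f) (X : 𝔤) :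
    Differentiable ℂ (fun t : ℂ => f (expElt h𝔤 (t • X))) := by
  obtain ⟨p, hp⟩ := hf
  have h1 : (fun t : ℂ => f (expElt h𝔤 (t • X))) =
      fun t : ℂ => regularEval p (NormedSpace.exp (t • (X : Matrix (Fin n) (Fin n) ℂ))) :=
    funext fun t => by rw [hp, ← coe_expElt_smul h𝔤]; rfl
  rw [h1]
  exact differentiable_regularEval_exp p _

-- Induction on `g` as a product of exponentials. Since `f₁` stays nonzero at `exp (t X)` for small
-- `t`, the induction hypothesis for the left translates by `exp (t X)` gives `f₂ (exp (t X) g) = 0`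
-- there. Analyticity in `t` carries this to `t = 1`.
include h𝔤 in
lemma eq_zero_of_mul_eq_zero_of_apply_one (hgen : Subgroup.closure (Set.range (expElt h𝔤)) = ⊤)
    (g : G) : ∀ f₁ f₂ : G → ℂ, IsRegular G f₁ → IsRegular G f₂ → (∀ x, f₁ x * f₂ x = 0) →
      f₁ 1 ≠ 0 → f₂ g = 0 := by
  refine forall_of_closure h𝔤 hgen (p := fun g => ∀ f₁ f₂ : G → ℂ, IsRegular G f₁ →
    IsRegular G f₂ → (∀ x, f₁ x * f₂ x = 0) → f₁ 1 ≠ 0 → f₂ g = 0) ?_ ?_ g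
  · exact fun f₁ f₂ _ _ h h0 => (mul_eq_zero.mp (h 1)).resolve_left h0
  · intro X g ih f₁ f₂ h₁ h₂ h h0
    have d1 := h₁.differentiable_expElt h𝔤 X
    have d2 := (h₂.comp_mul_right g).differentiable_expElt h𝔤 X
    have hne : ∀ᶠ t in nhds (0 : ℂ), f₁ (expElt h𝔤 (t • X)) ≠ 0 :=
      d1.continuous.continuousAt.eventually_ne (by rwa [zero_smul, expElt_zero])
    have hev : (fun t : ℂ => f₂ (expElt h𝔤 (t • X) * g)) =ᶠ[nhds 0] fun _ => 0 := by
      filter_upwards [hne] with t ht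
      exact ih _ _ (h₁.comp_mul_left (expElt h𝔤 (t • X))) (h₂.comp_mul_left (expElt h𝔤 (t • X)))
        (fun x => h _) (by rwa [mul_one])
    have := AnalyticOnNhd.eq_of_eventuallyEq (fun t _ => d2.analyticAt t)
      (fun t _ => analyticAt_const) hev
    simpa using congrFun this 1

include h𝔤 in
/-- The algebra of regular functions on a group generated by exponentials is a domain. -/
theorem IsRegular.mul_ne_zero (hgen : Subgroup.closure (Set.range (expElt h𝔤)) = ⊤)
    {f₁ f₂ : G → ℂ} (h₁ : IsRegular G f₁) (h₂ : IsRegular G f₂) (h₁0 : f₁ ≠ 0) (h₂0 : f₂ ≠ 0) :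
    f₁ * f₂ ≠ 0 := by
  intro h
  obtain ⟨a, ha⟩ := Function.ne_iff.mp h₁0
  refine h₂0 (funext fun b => ?_)
  have := eq_zero_of_mul_eq_zero_of_apply_one h𝔤 hgen (a⁻¹ * b) _ _ (h₁.comp_mul_left a)
    (h₂.comp_mul_left a) (fun x => congrFun h (a * x)) (by rwa [mul_one])
  simpa using this

/-- The restriction of right translation to a stable space of functions. -/
def translationOn (U : Submodule ℂ (G → ℂ)) (hU : ∀ g, ∀ f ∈ U, rightTranslation G g f ∈ U) :
    Representation ℂ G U :=
  Subrepresentation.toRepresentation ⟨U, fun g f hf => hU g f hf⟩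

/-- Point evaluations separate functions and so span the dual of `U`. Their matrix coefficients are
left translates of regular functions. -/
lemma isRational_translationOn {U : Submodule ℂ (G → ℂ)} [FiniteDimensional ℂ U]
    (hU : ∀ g, ∀ f ∈ U, rightTranslation G g f ∈ U) (hreg : ∀ f ∈ U, IsRegular G f) :
    IsRational (translationOn U hU) := by
  let ev (x : G) : Dual ℂ U := LinearMap.proj x ∘ₗ U.subtype
  have htop : Submodule.span ℂ (Set.range ev) = ⊤ := by
    have h : (Submodule.span ℂ (Set.range ev)).dualCoannihilator = ⊥ := by
      rw [eq_bot_iff]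
      intro f hf
      rw [Submodule.mem_dualCoannihilator] at hf
      exact Subtype.ext (funext fun x => hf _ (Submodule.subset_span ⟨x, rfl⟩))
    rw [← Subspace.dualCoannihilator_dualAnnihilator_eq (W := Submodule.span ℂ (Set.range ev)), h,
      Submodule.dualAnnihilator_bot]
  intro φ f
  have hφ : φ ∈ Submodule.span ℂ (Set.range ev) := by rw [htop]; trivial
  rw [← mem_regularAlgebra_iff]
  induction hφ using Submodule.span_induction with
  | mem φ hφ =>
    obtain ⟨x, rfl⟩ := hφ
    exact mem_regularAlgebra_iff.mpr ((hreg f f.2).comp_mul_left x)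
  | zero => exact (regularAlgebra G).zero_mem
  | add φ ψ _ _ h1 h2 => exact (regularAlgebra G).add_mem h1 h2
  | smul a φ _ h => exact (regularAlgebra G).smul_mem h a

end RegularFunctions
end Branching

namespace Branching

open Module LieAlgebra

/-! ### Irreducible representations as spaces of semi-invariant functions -/

section SemiInvariants

variable {n : ℕ} {G : Subgroup (GL (Fin n) ℂ)} {𝔤 : LieSubalgebra ℂ (Matrix (Fin n) (Fin n) ℂ)}
  [LieAlgebra.IsSimple ℂ 𝔤] (h𝔤 : IsLieAlgebraOf 𝔤 G) {H : LieSubalgebra ℂ 𝔤}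
  [H.IsCartanSubalgebra] (b : (IsKilling.rootSystem H).Base)

/-- The functions on `G` on which the Borel subgroup opposite to `b` acts from the left by the
character with differential `l`. -/
def semiInvariants (l : Dual ℂ H) : Submodule ℂ (G → ℂ) where
  carrier := {f | (∀ (h : H) (x : G), f (expElt h𝔤 (h : 𝔤) * x) = Complex.exp (l h) * f x) ∧
    ∀ X ∈ oppositeNilradical b, ∀ x : G, f (expElt h𝔤 X * x) = f x}
  zero_mem' := by simp
  add_mem' := by
    rintro f₁ f₂ ⟨h₁, k₁⟩ ⟨h₂, k₂⟩
    exact ⟨fun h x => by simp only [Pi.add_apply, h₁, h₂]; ring,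
      fun X hX x => by simp only [Pi.add_apply, k₁ X hX, k₂ X hX]⟩
  smul_mem' := by
    rintro c f ⟨h₁, k₁⟩
    exact ⟨fun h x => by simp only [Pi.smul_apply, smul_eq_mul, h₁]; ring,
      fun X hX x => by simp only [Pi.smul_apply, k₁ X hX]⟩

variable {h𝔤 b} in
lemma mul_mem_semiInvariants {l₁ l₂ : Dual ℂ H} {f₁ f₂ : G → ℂ}
    (h₁ : f₁ ∈ semiInvariants h𝔤 b l₁) (h₂ : f₂ ∈ semiInvariants h𝔤 b l₂) :
    f₁ * f₂ ∈ semiInvariants h𝔤 b (l₁ + l₂) := by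
  refine ⟨fun h x => ?_, fun X hX x => ?_⟩
  · rw [Pi.mul_apply, h₁.1, h₂.1, LinearMap.add_apply, Complex.exp_add, Pi.mul_apply]
    ring
  · rw [Pi.mul_apply, h₁.2 X hX, h₂.2 X hX, Pi.mul_apply]

lemma IsHighestWeightVector.map {V V' : Type*} [AddCommGroup V] [Module ℂ V] [AddCommGroup V']
    [Module ℂ V'] {ρ : Representation ℂ G V} {ρ' : Representation ℂ G V'} {l : Dual ℂ H} {v : V}
    {b : (IsKilling.rootSystem H).Base} (hv : IsHighestWeightVector b ρ l v) {T : V →ₗ[ℂ] V'}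
    (hT : ∀ g v, T (ρ g v) = ρ' g (T v)) (h0 : T v ≠ 0) :
    IsHighestWeightVector b ρ' l (T v) := by
  obtain ⟨-, hH, hN⟩ := hv
  exact ⟨h0, fun h g hg => by rw [← hT, hH h g hg, map_smul],
    fun X hX g hg => by rw [← hT, hN X hX g hg]⟩

variable {V : Type*} [AddCommGroup V] [Module ℂ V] {ρ : Representation ℂ G V} {l : Dual ℂ H}
  {b : (IsKilling.rootSystem H).Base}

include h𝔤 in
/-- An irreducible representation embeds into the regular semi-invariant functions by means of its
lowest weight covector. -/
theorem IsHighestWeightRep.exists_embedding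
    (hgen : Subgroup.closure (Set.range (expElt h𝔤)) = ⊤) (hρ : IsHighestWeightRep b ρ l) :
    ∃ T : V →ₗ[ℂ] (G → ℂ), Function.Injective T ∧
      (∀ g v, T (ρ g v) = rightTranslation G g (T v)) ∧
      ∀ v, IsRegular G (T v) ∧ T v ∈ semiInvariants h𝔤 b l := by
  obtain ⟨hfin, hrat, hirr, v, hv⟩ := hρ
  let := diffLieRingModule h𝔤 hrat
  have := diffLieModule h𝔤 hrat
  have := isIrreducible_differential h𝔤 hrat hgen hirr
  rw [isHighestWeightVector_iff h𝔤 hrat] at hv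
  obtain ⟨ξ, hξv, hξ⟩ := hv.exists_covec fun N hN =>
    (eq_bot_or_eq_top N).resolve_left fun h => hv.ne_zero (by rw [h] at hN; simpa using hN)
  rw [isLowestWeightCovec_iff h𝔤 hrat] at hξ
  have hT (g : G) (w : V) : (LinearMap.pi fun g => ξ ∘ₗ ρ g : V →ₗ[ℂ] (G → ℂ)) (ρ g w) =
      rightTranslation G g ((LinearMap.pi fun g => ξ ∘ₗ ρ g : V →ₗ[ℂ] (G → ℂ)) w) :=
    funext fun x => by
      rw [rightTranslation_apply]
      simp
  refine ⟨LinearMap.pi fun g => ξ ∘ₗ ρ g, ?_, hT, fun w => ⟨hrat ξ w, fun h x => ?_,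
    fun X hX x => ?_⟩⟩
  -- The kernel is a subrepresentation, and it misses `v` because the image of `v` takes the value
  -- `ξ v = 1` at the identity.
  · rw [← LinearMap.ker_eq_bot]
    rcases eq_bot_or_eq_top (⟨LinearMap.ker (LinearMap.pi fun g => ξ ∘ₗ ρ g : V →ₗ[ℂ] (G → ℂ)),
      fun g w hw => by rw [LinearMap.mem_ker] at hw ⊢; rw [hT, hw, map_zero]⟩ :
        Subrepresentation ρ) with h | h
    · exact congrArg Subrepresentation.toSubmodule h
    · have hker : v ∈ LinearMap.ker (LinearMap.pi fun g => ξ ∘ₗ ρ g : V →ₗ[ℂ] (G → ℂ)) := by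
        have := congrArg Subrepresentation.toSubmodule h
        rw [show LinearMap.ker (LinearMap.pi fun g => ξ ∘ₗ ρ g : V →ₗ[ℂ] (G → ℂ)) = ⊤ from this]
        trivial
      have h1 := congrFun (LinearMap.mem_ker.mp hker) 1
      simp [hξv] at h1
  · simp [hξ.1]
  · simp [hξ.2 X hX]

include h𝔤 in
/-- A nonzero regular semi-invariant function has a nonzero image in the irreducible
representation of its weight under an equivariant map. -/
theorem IsHighestWeightRep.exists_equivariant
    (hgen : Subgroup.closure (Set.range (expElt h𝔤)) = ⊤) (hρ : IsHighestWeightRep b ρ l)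
    {f : G → ℂ} (hreg : IsRegular G f) (hf : f ∈ semiInvariants h𝔤 b l) (hf0 : f ≠ 0) :
    ∃ (U : Submodule ℂ (G → ℂ)) (hU : ∀ g, ∀ F ∈ U, rightTranslation G g F ∈ U) (hfU : f ∈ U)
      (q : U →ₗ[ℂ] V), (∀ g F, q (translationOn U hU g F) = ρ g (q F)) ∧ q ⟨f, hfU⟩ ≠ 0 := by
  obtain ⟨hfin, hrat, hirr, v, hv⟩ := hρ
  obtain ⟨d, hd⟩ := exists_mem_coordSpan_pow hreg
  have := finite_coordSpan_pow (G := G) d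
  -- Semi-invariance concerns left translation, which commutes with right translation, so `U` stays
  -- stable.
  let U : Submodule ℂ (G → ℂ) := coordSpan G ^ d ⊓ semiInvariants h𝔤 b l
  have hU (g : G) : ∀ F ∈ U, rightTranslation G g F ∈ U := fun F hF =>
    ⟨rightTranslation_mem_pow g d hF.1, fun h x => by
      rw [rightTranslation_apply, mul_assoc, hF.2.1, rightTranslation_apply], fun X hX x => by
      rw [rightTranslation_apply, mul_assoc, hF.2.2 X hX, rightTranslation_apply]⟩
  have : FiniteDimensional ℂ U := Submodule.finiteDimensional_inf_left _ _
  have hratU : IsRational (translationOn U hU) := isRational_translationOn hU fun F hF =>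
    mem_regularAlgebra_iff.mp (coordSpan_pow_le d hF.1)
  let := diffLieRingModule h𝔤 hrat
  have := diffLieModule h𝔤 hrat
  have := isIrreducible_differential h𝔤 hrat hgen hirr
  let := diffLieRingModule h𝔤 hratU
  have := diffLieModule h𝔤 hratU
  rw [isHighestWeightVector_iff h𝔤 hrat] at hv
  let ev (x : G) : Dual ℂ U := LinearMap.proj x ∘ₗ U.subtype
  -- At the identity, left and right translation by an exponential agree, so left semi-invariance
  -- says that `ev 1` has weight `l` and is fixed by `exp 𝔫⁻`.
  have hev : IsLowestWeightCovec b l (ev 1) := by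
    rw [isLowestWeightCovec_iff h𝔤 hratU]
    refine ⟨fun h F => ?_, fun X hX F => ?_⟩
    · have := F.2.2.1 h 1
      rw [mul_one] at this
      change F.val (1 * _) = _
      rw [one_mul, this]
      rfl
    · have := F.2.2.2 X hX 1
      rw [mul_one] at this
      change F.val (1 * _) = _
      rw [one_mul, this]
      rfl
  obtain ⟨g, hg⟩ := Function.ne_iff.mp hf0
  obtain ⟨A, p, hA, hpA, hp0⟩ := exists_irreducible_projection (𝕜 := ℂ) (L := 𝔤) (ev g)
    (⟨f, hd, hf⟩ : U) hg
  have hpu : p ⟨f, hd, hf⟩ ≠ 0 := fun h => hp0 (by rw [h, map_zero])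
  have : Nontrivial A := ⟨⟨⟨_, hpA ⟨f, hd, hf⟩⟩, 0, fun h => hpu (congrArg Subtype.val h)⟩⟩
  have : LieModule.IsIrreducible ℂ 𝔤 A := by
    refine LieModule.IsIrreducible.mk fun N hN => ?_
    have hle : N.map A.incl ≤ A := by
      rw [LieSubmodule.map_le_iff_le_comap]
      exact fun x _ => x.2
    have hmap : N.map A.incl = A := hA _ hle fun h => hN <| by
      rw [eq_bot_iff]
      intro x hx
      have h1 : A.incl x ∈ N.map A.incl := LieSubmodule.mem_map_of_mem hx
      rw [h, LieSubmodule.mem_bot] at h1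
      exact Subtype.ext h1
    rw [eq_top_iff]
    rintro x -
    have h1 : (x : U) ∈ N.map A.incl := by
      rw [hmap]
      exact x.2
    obtain ⟨y, hy, hyx⟩ := (LieSubmodule.mem_map _).mp h1
    rwa [← (Subtype.ext hyx : y = x)]
  let η : Dual ℂ A := ev 1 ∘ₗ A.toSubmodule.subtype
  have hη : IsLowestWeightCovec b l η :=
    ⟨fun h w => hev.apply_cartan h w, fun X hX w => hev.apply_nilradical X hX w⟩
  -- Right translation by `g` turns evaluation at `1` into evaluation at `g`, which is nonzero on `p
  -- f`.
  have hη0 : η ≠ 0 := by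
    intro h
    have hmem := apply_mem_of_differential_mem h𝔤 hratU hgen (W := A.toSubmodule)
      (fun X w hw => A.lie_mem hw) g _ (hpA ⟨f, hd, hf⟩)
    refine hp0 ?_
    have h1 := LinearMap.congr_fun h ⟨_, hmem⟩
    change (p ⟨f, hd, hf⟩).val (1 * g) = 0 at h1
    rwa [one_mul] at h1
  obtain ⟨e, he⟩ := exists_injective_lieModuleHom hη hη0 hv
  let q : U →ₗ[ℂ] V := (e : A →ₗ[ℂ] V) ∘ₗ LinearMap.codRestrict A.toSubmodule (p : U →ₗ[ℂ] U) hpA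
  refine ⟨U, hU, ⟨hd, hf⟩, q, fun x => ?_, fun h => ?_⟩
  · refine equivariant_of_differential h𝔤 hratU hrat hgen (fun X F => ?_) x
    have h1 : p ⁅X, F⁆ = ⁅X, p F⁆ := p.map_lie X F
    have h2 := e.map_lie X ⟨p F, hpA F⟩
    refine Eq.trans (congrArg e (Subtype.ext ?_)) h2
    exact h1
  · have h1 : (⟨p ⟨f, hd, hf⟩, hpA _⟩ : A) = 0 := he (h.trans (map_zero e).symm)
    exact hpu (congrArg Subtype.val h1)

end SemiInvariants

/-! ### Occurrence in terms of highest weight vectors -/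

section Occurrence

variable {n : ℕ} {G : Subgroup (GL (Fin n) ℂ)} {𝔤 : LieSubalgebra ℂ (Matrix (Fin n) (Fin n) ℂ)}
  [LieAlgebra.IsSimple ℂ 𝔤] {H : LieSubalgebra ℂ 𝔤}
  [H.IsCartanSubalgebra] {b : (IsKilling.rootSystem H).Base} {l : Dual ℂ H}
  {V : Type*} [AddCommGroup V] [Module ℂ V] {ρ : Representation ℂ G V}

lemma Occurs.exists_isHighestWeightVector (h : Occurs b l ρ) :
    ∃ v, IsHighestWeightVector b ρ l v := by
  obtain ⟨W, _, _, σ, ⟨hfin, hrat, hirr, w, hw⟩, hm⟩ := h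
  have := nontrivial_of_finrank_pos hm
  obtain ⟨T, hT⟩ := exists_ne (0 : Representation.IntertwiningMap σ ρ)
  have hinj := (Representation.IsIrreducible.injective_or_eq_zero T).resolve_right hT
  refine ⟨T w, hw.map (T := T.toLinearMap) (fun g v => Representation.IntertwiningMap.isIntertwining σ ρ T g v) ?_⟩
  exact fun h => hw.1 (hinj (h.trans (map_zero T).symm))

/-- By complete reducibility `v` has a nonzero projection to some irreducible submodule. The
projection is equivariant, so this image is still a highest weight vector of weight `l`. -/
lemma occurs_of_isHighestWeightVector (h𝔤 : IsLieAlgebraOf 𝔤 G)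
    (hgen : Subgroup.closure (Set.range (expElt h𝔤)) = ⊤) [FiniteDimensional ℂ V]
    (hrat : IsRational ρ) {v : V} (hv : IsHighestWeightVector b ρ l v) : Occurs b l ρ := by
  let := diffLieRingModule h𝔤 hrat
  have := diffLieModule h𝔤 hrat
  obtain ⟨φ, hφ⟩ : ∃ φ : Dual ℂ V, φ v ≠ 0 := by
    by_contra! h
    exact hv.1 ((forall_dual_apply_eq_zero_iff ℂ v).mp h)
  obtain ⟨A, p, hA, hpA, hp0⟩ := exists_irreducible_projection (𝕜 := ℂ) (L := 𝔤) φ v hφ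
  have hpv : p v ≠ 0 := fun h => hp0 (by rw [h, map_zero])
  have hstab := apply_mem_of_differential_mem h𝔤 hrat hgen (W := A.toSubmodule)
    (fun X w hw => A.lie_mem hw)
  have hpeq := equivariant_of_differential h𝔤 hrat hrat hgen (f := (p : V →ₗ[ℂ] V))
    (fun X w => p.map_lie X w)
  -- Coordinates move the submodule into `Type`, as `Occurs` demands, whatever the universe of `V`.
  let e : A.toSubmodule ≃ₗ[ℂ] (Fin (finrank ℂ A.toSubmodule) → ℂ) :=
    (finBasis ℂ A.toSubmodule).equivFun
  let σA : Representation ℂ G A.toSubmodule :=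
    Subrepresentation.toRepresentation ⟨A.toSubmodule, fun g w hw => hstab g w hw⟩
  let σ : Representation ℂ G (Fin (finrank ℂ A.toSubmodule) → ℂ) :=
    { toFun := fun g => e.conj (σA g)
      map_one' := by ext; simp
      map_mul' := fun g h => by ext; simp }
  let j : (Fin (finrank ℂ A.toSubmodule) → ℂ) →ₗ[ℂ] V := A.toSubmodule.subtype ∘ₗ e.symm.toLinearMap
  have hj : Function.Injective j := Subtype.val_injective.comp e.symm.injective
  have hjA (x) : j x ∈ A := (e.symm x).2
  have hσ (g : G) (x) : j (σ g x) = ρ g (j x) := by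
    change ((e.symm (e (σA g (e.symm x))) : A.toSubmodule) : V) = _
    rw [e.symm_apply_apply]
    rfl
  have hjv : j (e ⟨p v, hpA v⟩) = p v := by
    change ((e.symm (e _) : A.toSubmodule) : V) = _
    rw [e.symm_apply_apply]
  have hne : e ⟨p v, hpA v⟩ ≠ 0 := fun h => hpv (by rw [← hjv, h, map_zero])
  refine ⟨_, _, _, σ, ⟨inferInstance, ?_, ?_, e ⟨p v, hpA v⟩, ?_⟩, ?_⟩
  · intro ψ x
    obtain ⟨ψ', hψ'⟩ := LinearMap.exists_extend (ψ ∘ₗ e.toLinearMap)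
    have : (fun g => ψ (σ g x)) = fun g => ψ' (ρ g (j x)) := funext fun g => by
      rw [← hσ]
      have := LinearMap.congr_fun hψ' (e.symm (σ g x))
      simp only [LinearMap.comp_apply, LinearEquiv.coe_coe, e.apply_symm_apply] at this
      exact this.symm
    rw [this]
    exact hrat ψ' (j x)
  · have hall (N : Subrepresentation σ) : N = ⊥ ∨ N = ⊤ := by
      by_cases hN : N.toSubmodule = ⊥
      · exact Or.inl (Subrepresentation.toSubmodule_injective hN)
      refine Or.inr (Subrepresentation.toSubmodule_injective ?_)
      have hst (g : G) : ∀ w ∈ N.toSubmodule.map j, ρ g w ∈ N.toSubmodule.map j := by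
        rintro _ ⟨x, hx, rfl⟩
        exact ⟨σ g x, N.apply_mem_toSubmodule g hx, hσ g x⟩
      let N' : LieSubmodule ℂ 𝔤 V :=
        { N.toSubmodule.map j with
          lie_mem := fun {X w} hw => differential_mem h𝔤 hrat hst X hw }
      have hN' : N' = A := by
        refine hA N' ?_ fun h => hN ?_
        · rintro _ ⟨x, -, rfl⟩
          exact hjA x
        · have : N.toSubmodule.map j = ⊥ := congrArg LieSubmodule.toSubmodule h
          exact Submodule.map_injective_of_injective hj (this.trans (Submodule.map_bot j).symm)
      refine (eq_top_iff.mpr ?_ : N.toSubmodule = ⊤)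
      rintro x -
      have : j x ∈ N' := by rw [hN']; exact hjA x
      obtain ⟨y, hy, hyx⟩ := this
      rwa [← hj hyx]
    have : Nontrivial (Subrepresentation σ) := by
      refine ⟨⊥, ⊤, fun h => hne ?_⟩
      have h1 : (⊥ : Submodule ℂ (Fin (finrank ℂ A.toSubmodule) → ℂ)) = ⊤ :=
        congrArg Subrepresentation.toSubmodule h
      rw [← Submodule.mem_bot ℂ, h1]
      trivial
    exact { eq_bot_or_eq_top := hall }
  · refine hv.map (T := e.toLinearMap ∘ₗ LinearMap.codRestrict A.toSubmodule (p : V →ₗ[ℂ] V) hpA)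
      (fun g w => hj ?_) hne
    rw [hσ]
    change ((e.symm (e _) : A.toSubmodule) : V) = ρ g ((e.symm (e _) : A.toSubmodule) : V)
    rw [e.symm_apply_apply, e.symm_apply_apply]
    exact hpeq g w
  · let T : Representation.IntertwiningMap σ ρ := j.intertwiningMap_of_isIntertwiningMap _ _ hσ
    have hT : T ≠ 0 := fun h => hpv (by rw [← hjv]; exact DFunLike.congr_fun h _)
    have : Nontrivial (Representation.IntertwiningMap σ ρ) := ⟨T, 0, hT⟩
    exact finrank_pos

end Occurrence
end Branching

namespace Branching

open Module LieAlgebra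

/-! ### Branching functions and the semigroup property -/

section Main

variable {n : ℕ} {K : Subgroup (GL (Fin n) ℂ)} {𝔨 : LieSubalgebra ℂ (Matrix (Fin n) (Fin n) ℂ)}
  [LieAlgebra.IsSimple ℂ 𝔨] {S : Subgroup (GL (Fin n) ℂ)}
  {𝔰 : LieSubalgebra ℂ (Matrix (Fin n) (Fin n) ℂ)} [LieAlgebra.IsSimple ℂ 𝔰] (h𝔨 : IsLieAlgebraOf 𝔨 K)
  {hSK : S ≤ K} {HK : LieSubalgebra ℂ 𝔨} [HK.IsCartanSubalgebra]
  {bK : (IsKilling.rootSystem HK).Base} {HS : LieSubalgebra ℂ 𝔰} [HS.IsCartanSubalgebra]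
  {bS : (IsKilling.rootSystem HS).Base} {l l₁ l₂ : Dual ℂ HK} {m m₁ m₂ : Dual ℂ HS}

lemma IsHighestWeightVector.mul {f₁ f₂ : K → ℂ}
    (h₁ : IsHighestWeightVector bS (res hSK (rightTranslation K)) m₁ f₁)
    (h₂ : IsHighestWeightVector bS (res hSK (rightTranslation K)) m₂ f₂) (h0 : f₁ * f₂ ≠ 0) :
    IsHighestWeightVector bS (res hSK (rightTranslation K)) (m₁ + m₂) (f₁ * f₂) := by
  have hmul (g : S) : res hSK (rightTranslation K) g (f₁ * f₂) =
      res hSK (rightTranslation K) g f₁ * res hSK (rightTranslation K) g f₂ := rfl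
  refine ⟨h0, fun h g hg => ?_, fun X hX g hg => ?_⟩
  · rw [hmul, h₁.2.1 h g hg, h₂.2.1 h g hg, smul_mul_smul_comm, ← Complex.exp_add,
      LinearMap.add_apply]
  · rw [hmul, h₁.2.2 X hX g hg, h₂.2.2 X hX g hg]

/-- The function `f` is regular and nonzero, a semi-invariant of weight `l` for left translation
by a Borel subgroup of `K`, and a highest weight vector of weight `m` for right translation by
`S`. -/
structure IsBranchingFunction (hSK : S ≤ K) (bK : (IsKilling.rootSystem HK).Base)
    (bS : (IsKilling.rootSystem HS).Base) (l : Dual ℂ HK) (m : Dual ℂ HS) (f : K → ℂ) : Prop where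
  regular : IsRegular K f
  left : f ∈ semiInvariants h𝔨 bK l
  right : IsHighestWeightVector bS (res hSK (rightTranslation K)) m f

variable {h𝔨}

lemma IsBranchingFunction.mul (hgen : Subgroup.closure (Set.range (expElt h𝔨)) = ⊤)
    {f₁ f₂ : K → ℂ} (h₁ : IsBranchingFunction h𝔨 hSK bK bS l₁ m₁ f₁)
    (h₂ : IsBranchingFunction h𝔨 hSK bK bS l₂ m₂ f₂) :
    IsBranchingFunction h𝔨 hSK bK bS (l₁ + l₂) (m₁ + m₂) (f₁ * f₂) :=
  ⟨h₁.regular.mul h₂.regular, mul_mem_semiInvariants h₁.left h₂.left,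
    h₁.right.mul h₂.right (h₁.regular.mul_ne_zero h𝔨 hgen h₂.regular h₁.right.1 h₂.right.1)⟩

variable {V : Type*} [AddCommGroup V] [Module ℂ V] {ρ : Representation ℂ K V}

lemma IsRegular.restrict (hSK : S ≤ K) {f : K → ℂ} (hf : IsRegular K f) :
    IsRegular S (fun g => f (Subgroup.inclusion hSK g)) := by
  obtain ⟨p, hp⟩ := hf
  exact ⟨p, fun g => hp _⟩

lemma IsHighestWeightRep.exists_isBranchingFunction
    (hgen : Subgroup.closure (Set.range (expElt h𝔨)) = ⊤) (hρ : IsHighestWeightRep bK ρ l) {v : V}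
    (hv : IsHighestWeightVector bS (res hSK ρ) m v) :
    ∃ f, IsBranchingFunction h𝔨 hSK bK bS l m f := by
  obtain ⟨T, hinj, hT, hmem⟩ := hρ.exists_embedding h𝔨 hgen
  exact ⟨T v, (hmem v).1, (hmem v).2, hv.map (fun g w => hT _ w) fun h =>
    hv.1 (hinj (h.trans (map_zero T).symm))⟩

/-- The map `q` to `L_K(l)` commutes with `K`, hence with `S`, and does not kill `f`, so `q f` is a
highest weight vector for `S` of weight `m`. -/
lemma IsBranchingFunction.occurs (hgen : Subgroup.closure (Set.range (expElt h𝔨)) = ⊤)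
    (h𝔰 : IsLieAlgebraOf 𝔰 S) (hgenS : Subgroup.closure (Set.range (expElt h𝔰)) = ⊤) {f : K → ℂ}
    (hf : IsBranchingFunction h𝔨 hSK bK bS l m f) (hρ : IsHighestWeightRep bK ρ l) :
    Occurs bS m (res hSK ρ) := by
  obtain ⟨U, hU, hfU, q, hq, hq0⟩ := hρ.exists_equivariant h𝔨 hgen hf.regular hf.left hf.right.1
  have hfin := hρ.finite
  have hu : IsHighestWeightVector bS (res hSK (translationOn U hU)) m ⟨f, hfU⟩ :=
    ⟨fun h => hf.right.1 (congrArg Subtype.val h),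
      fun h g hg => Subtype.ext (hf.right.2.1 h g hg),
      fun X hX g hg => Subtype.ext (hf.right.2.2 X hX g hg)⟩
  exact occurs_of_isHighestWeightVector h𝔰 hgenS
    (fun φ v => (hρ.rational φ v).restrict hSK) (hu.map (fun g F => hq _ F) hq0)

lemma isHighestWeightVector_zero_of_mem_invariants {σ : Representation ℂ S V} {v : V}
    (hv : v ∈ σ.invariants) (h0 : v ≠ 0) : IsHighestWeightVector bS σ 0 v :=
  ⟨h0, fun h g _ => by rw [(Representation.mem_invariants σ v).mp hv g]; simp,
    fun X _ g _ => (Representation.mem_invariants σ v).mp hv g⟩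

end Main

end Branching

theorem mainTheorem7 {n : ℕ}
    -- the simply connected group `K`, with simple Lie algebra `𝔨`
    (K : Subgroup (GL (Fin n) ℂ)) (𝔨 : LieSubalgebra ℂ (Matrix (Fin n) (Fin n) ℂ))
    [LieAlgebra.IsSimple ℂ 𝔨] (hK : Branching.IsZariskiClosed K) [SimplyConnectedSpace K]
    (h𝔨 : Branching.IsLieAlgebraOf 𝔨 K)
    -- the connected Zariski closed subgroup `S` of `K`, with simple Lie algebra `𝔰`
    (S : Subgroup (GL (Fin n) ℂ)) (𝔰 : LieSubalgebra ℂ (Matrix (Fin n) (Fin n) ℂ))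
    [LieAlgebra.IsSimple ℂ 𝔰] (hS : Branching.IsZariskiClosed S) [ConnectedSpace S]
    (h𝔰 : Branching.IsLieAlgebraOf 𝔰 S) (hSK : S ≤ K)
    -- Cartan subalgebras and simple roots
    (HK : LieSubalgebra ℂ 𝔨) [HK.IsCartanSubalgebra]
    (bK : (LieAlgebra.IsKilling.rootSystem HK).Base)
    (HS : LieSubalgebra ℂ 𝔰) [HS.IsCartanSubalgebra]
    (bS : (LieAlgebra.IsKilling.rootSystem HS).Base) :
    (∀ l₁ ∈ Branching.dominantWeights bK, ∀ l₂ ∈ Branching.dominantWeights bK,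
      ∀ m₁ ∈ Branching.dominantWeights bS, ∀ m₂ ∈ Branching.dominantWeights bS,
      ∀ (V₁ : Type*) [AddCommGroup V₁] [Module ℂ V₁] (ρ₁ : Representation ℂ K V₁)
        (V₂ : Type*) [AddCommGroup V₂] [Module ℂ V₂] (ρ₂ : Representation ℂ K V₂)
        (V : Type*) [AddCommGroup V] [Module ℂ V] (ρ : Representation ℂ K V),
        Branching.IsHighestWeightRep bK ρ₁ l₁ →
        Branching.IsHighestWeightRep bK ρ₂ l₂ →
        Branching.IsHighestWeightRep bK ρ (l₁ + l₂) →
        Branching.Occurs bS m₁ (Branching.res hSK ρ₁) →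
        Branching.Occurs bS m₂ (Branching.res hSK ρ₂) →
        Branching.Occurs bS (m₁ + m₂) (Branching.res hSK ρ)) ∧
    (∀ l₁ ∈ Branching.dominantWeights bK, ∀ l₂ ∈ Branching.dominantWeights bK,
      ∀ m ∈ Branching.dominantWeights bS,
      ∀ (V₁ : Type*) [AddCommGroup V₁] [Module ℂ V₁] (ρ₁ : Representation ℂ K V₁)
        (V₂ : Type*) [AddCommGroup V₂] [Module ℂ V₂] (ρ₂ : Representation ℂ K V₂),
        Branching.IsHighestWeightRep bK ρ₁ l₁ →
        Branching.IsHighestWeightRep bK ρ₂ l₂ →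
        (Branching.res hSK ρ₂).invariants ≠ ⊥ →
        Branching.Occurs bS m (Branching.res hSK ρ₁) →
        ∀ (k : ℕ) (V : Type*) [AddCommGroup V] [Module ℂ V] (ρ : Representation ℂ K V),
          Branching.IsHighestWeightRep bK ρ (l₁ + k • l₂) →
          Branching.Occurs bS m (Branching.res hSK ρ)) := by
  -- Connectedness of `K` is supplied by its simple connectedness.
  have hgen := Branching.closure_range_expElt hK h𝔨
  have hgenS := Branching.closure_range_expElt hS h𝔰
  refine ⟨?_, ?_⟩
  · intro l₁ _ l₂ _ m₁ _ m₂ _ V₁ _ _ ρ₁ V₂ _ _ ρ₂ V _ _ ρ h₁ h₂ h o₁ o₂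
    obtain ⟨v₁, hv₁⟩ := o₁.exists_isHighestWeightVector
    obtain ⟨v₂, hv₂⟩ := o₂.exists_isHighestWeightVector
    obtain ⟨f₁, hf₁⟩ := h₁.exists_isBranchingFunction hgen hv₁
    obtain ⟨f₂, hf₂⟩ := h₂.exists_isBranchingFunction hgen hv₂
    exact (hf₁.mul hgen hf₂).occurs hgen h𝔰 hgenS h
  · intro l₁ _ l₂ _ m _ V₁ _ _ ρ₁ V₂ _ _ ρ₂ h₁ h₂ hinv o₁ k V _ _ ρ h
    obtain ⟨v₁, hv₁⟩ := o₁.exists_isHighestWeightVector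
    obtain ⟨f₁, hf₁⟩ := h₁.exists_isBranchingFunction hgen hv₁
    obtain ⟨w, hw, hw0⟩ := Submodule.exists_mem_ne_zero_of_ne_bot hinv
    obtain ⟨f₂, hf₂⟩ := h₂.exists_isBranchingFunction hgen
      (Branching.isHighestWeightVector_zero_of_mem_invariants (bS := bS) hw hw0)
    -- The function is `f₁` times the `k`-th power of `f₂`, where `f₂` comes from an invariant
    -- vector and has right weight zero.
    have hpow (k : ℕ) : ∃ f, Branching.IsBranchingFunction h𝔨 hSK bK bS (l₁ + k • l₂) m f := by
      induction k with
      | zero => exact ⟨f₁, by rwa [zero_smul, add_zero]⟩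
      | succ k ih =>
        obtain ⟨f, hf⟩ := ih
        have := hf.mul hgen hf₂
        rw [add_zero, add_assoc, ← succ_nsmul] at this
        exact ⟨_, this⟩
    obtain ⟨f, hf⟩ := hpow k
    exact hf.occurs hgen h𝔰 hgenS h
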